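/- Let $\theta>0$, $\omega=2\pi/\theta$, $\lambda\in\mathbb R$ and $\mu_0\in\mathbb R\setminus\{0\}$. On $\mathbb C^2$ put $d\mu(z,\bar z)=(\omega/\pi)^2e^{-\omega|z|^2}d^4z$, $\langle\varphi,\chi\rangle=\int d\mu\,\overline{\varphi}\,\chi$ and $I(z,\bar w)=e^{\omega\bar w\cdot z}$. Let $\mathcal E$ be the image of $\mathcal S(\mathbb R^2)$ under the Bargmann transform $$(Bf)(z)=(\omega/\pi)^{1/2}\int_{\mathbb R^2}dx\,e^{-\frac{\omega}{2}\sum_i(x_i^2+z_i^2)+\sqrt2\,\omega\, z\cdot x}f(x),$$ i.e. the Heisenberg module over the four-dimensional noncommutative torus $\mathcal A_\theta$ in the holomorphic representation. The generators $U_\gamma$ of $\mathcal A_\theta$, $\gamma\in\Gamma=\{\frac{\theta}{\sqrt2}(m+in):m,n\in\mathbb Z^2\}$, act by $(\varphi U_\gamma)(z)=e^{-\frac{\omega}{2}|\gamma|^2-\omega\bar\gamma\cdot z}\varphi(z+\gamma)$; for every $v\in\mathbb C^2$ let $U_v(z,\bar w)=e^{-\frac{\omega}{2}|v|^2-\omega\bar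 v\cdot z}I(z+v,\bar w)$ be the kernel of the same operator with $\gamma$ replaced by $v$. Put $(\varphi,\chi)_{\mathcal A_\theta}=\sum_{\gamma\in\Gamma}\langle\varphi,\chi U_\gamma\rangle U_{-\gamma}$ and $\mathrm{Tr}_{\mathcal A_\theta}[\sum_\gamma a_\gamma U_\gamma]=a_0$. Consider the theory on $\mathcal E$ with action $\mathrm{Tr}_{\mathcal A_\theta}\big[(\phi,H\phi)_{\mathcal A_\theta}+\frac\lambda2(\phi,\phi)_{\mathcal A_\theta}^2\big]$, $H=2\omega\sum_{i}z_i\partial_{z_i}+\mu_0^2$ (the harmonic oscillator Hamiltonian, its zero-point energy $2\omega$ being counted in the parameter $\mu_0^2$). For $\epsilon>0$ its Feynman rules are the regularized propagator $$H_\epsilon^{-1}(z,\bar w)=\tfrac12\int_\epsilon^\infty d\beta\,e^{-\beta\mu_0^2/2}\,I(z,e^{-\beta\omega}\bar w)$$ and the vertex $V=\sum_{\gamma\in\Gamma}V_\gamma$, where for $v\in\mathbb C^2$ one puts $V_v(z_1,\bar z_2,z_3,\bar z_4)=\frac\lambda2 U_v(z_1,\bar z_2)U_{-v}(z_3,\bar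 z_4)$. The one-loop two-point 1PI function is $\Gamma^{(1)}_2=\Gamma^{(1)}_{2a}[V]+\Gamma^{(1)}_{2b}[V]$, with $$\Gamma^{(1)}_{2a}[W](z_1,\bar z_2)=2\int d\mu(z_3,\bar z_3)\,d\mu(z_4,\bar z_4)\,W(z_1,\bar z_2,z_3,\bar z_4)\,H^{-1}_\epsilon(z_4,\bar z_3),$$ $$\Gamma^{(1)}_{2b}[W](z_1,\bar z_2)=2\int d\mu(z_3,\bar z_3)\,d\mu(z_4,\bar z_4)\,W(z_1,\bar z_4,z_3,\bar z_2)\,H^{-1}_\epsilon(z_4,\bar z_3).$$ Kernels are evaluated on external fields by $G[\overline{\varphi_1},\varphi_2]=\int d\mu(z_1,\bar z_1)d\mu(z_2,\bar z_2)\,\overline{\varphi_1(z_1)}\,\varphi_2(z_2)\,G(z_1,\bar z_2)$. The contribution of $\gamma\in\Gamma$ to the first graph is $\Gamma^{(1)}_{2a}[V_\gamma]$. The contribution of $\gamma^*=\frac1{\sqrt2}(k_1+ik_2)$, $k=(k_1,k_2)\in\mathbb Z^2\times\mathbb Z^2$, to the second graph after Poisson resummation is the Fourier coefficient $$\int_{\mathbb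 R^2\times\mathbb R^2}dx\,dy\,e^{-2\pi i(k_1\cdot x+k_2\cdot y)}\,\Gamma^{(1)}_{2b}\big[V_{\frac{\theta}{\sqrt2}(x+iy)}\big].$$ Then for all $\varphi_1,\varphi_2\in\mathcal E$ the following hold. 1. For every $\epsilon>0$ all these series and integrals converge absolutely. 2. The divergent part of $\Gamma^{(1)}_2[\overline{\varphi_1},\varphi_2]$ as $\epsilon\to0^+$ is $$\frac{\lambda}{2\omega}\Big(1+\frac1{\theta^2}\Big)\mathrm{Tr}_{\mathcal A_\theta}\big[(\varphi_1,\varphi_2)_{\mathcal A_\theta}\big]\Big(\frac1{\epsilon\omega}+\Big(1-\frac{\mu_0^2}{2\omega}\Big)\ln\frac1\epsilon\Big),$$ that is, the difference of $\Gamma^{(1)}_2[\overline{\varphi_1},\varphi_2]$ and this expression has a finite limit. 3. Only the zero modes diverge. On the external fields $\overline{\varphi_1},\varphi_2$, for every $\epsilon>0$ the first graph $\Gamma^{(1)}_{2a}[V]$ is the sum of the contributions of all $\gamma$, and the second graph $\Gamma^{(1)}_{2b}[V]$ is the sum of the contributions of all $\gamma^*$. For each graph, every contribution with $\gamma\neq0$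 (respectively $\gamma^*\neq0$) has a finite limit as $\epsilon\to0^+$, and the sum of all these contributions converges to the absolutely convergent sum of the limits. The contributions of $\gamma=0$ and of $\gamma^*=0$ have the divergent parts $$\frac{\lambda}{2\omega}\,\mathrm{Tr}_{\mathcal A_\theta}\big[(\varphi_1,\varphi_2)_{\mathcal A_\theta}\big]\Big(\frac1{\epsilon\omega}+\Big(1-\frac{\mu_0^2}{2\omega}\Big)\ln\frac1\epsilon\Big)$$ and $\theta^{-2}$ times this expression, respectively. -/

import Mathlib

open MeasureTheory Filter Topology Complex
open scoped ComplexConjugate SchwartzMap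

noncomputable section

namespace HeisenbergModule

/-- The phase space `ℂ²`, carrying the product Lebesgue measure. -/
abbrev Phase : Type := Fin 2 → ℂ

/-- Labels `(m, n)`, with `m, n ∈ ℤ²`, of the points of the lattice and of the dual lattice. -/
abbrev Label : Type := (Fin 2 → ℤ) × (Fin 2 → ℤ)

/-- The oscillator frequency `ω = 2π/θ`. -/
def freq (θ : ℝ) : ℝ := 2 * Real.pi / θ

/-- `cdot w z = w̄ · z`. -/
def cdot (w z : Phase) : ℂ := ∑ i, conj (w i) * z i

/-- `nsq z = |z|²`. -/
def nsq (z : Phase) : ℝ := ∑ i, ‖z i‖ ^ 2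

/-- The Gaussian probability measure `dμ(z, z̄) = (ω/π)² exp(-ω |z|²) d⁴z` on `ℂ²`. -/
def gauss (θ : ℝ) : Measure Phase :=
  volume.withDensity fun z =>
    ENNReal.ofReal ((freq θ / Real.pi) ^ 2 * Real.exp (-freq θ * nsq z))

/-- The Bargmann scalar product, antilinear in the first argument. -/
def scalar (θ : ℝ) (φ χ : Phase → ℂ) : ℂ := ∫ z, conj (φ z) * χ z ∂gauss θ

/-- The unitary Bargmann transform from functions on `ℝ²` to functions on `ℂ²`. -/
def bargmann (θ : ℝ) (f : 𝓢(Fin 2 → ℝ, ℂ)) (z : Phase) : ℂ :=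
  (Real.sqrt (freq θ / Real.pi) : ℂ) *
    ∫ x : Fin 2 → ℝ,
      cexp (-(freq θ : ℂ) / 2 * ∑ i, ((x i : ℂ) ^ 2 + z i ^ 2)
        + (Real.sqrt 2 : ℂ) * freq θ * ∑ i, z i * (x i : ℂ)) * f x

/-- The smooth Heisenberg module in the holomorphic representation: the image of the Schwartz
space of `ℝ²` under the Bargmann transform. -/
def smoothModule (θ : ℝ) : Set (Phase → ℂ) := Set.range (bargmann θ)

/-- The projective action of translations:
`(T_v φ)(z) = exp(-ω |v|²/2 - ω v̄·z) φ(z + v)`. -/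
def translation (θ : ℝ) (v : Phase) (φ : Phase → ℂ) (z : Phase) : ℂ :=
  cexp (-(freq θ : ℂ) * nsq v / 2 - freq θ * cdot v z) * φ (z + v)

/-- The point `(θ/√2)(x + i y)` of `ℂ²`. -/
def phasePoint (θ : ℝ) (p : (Fin 2 → ℝ) × (Fin 2 → ℝ)) : Phase :=
  fun i => ((θ / Real.sqrt 2 : ℝ) : ℂ) * ((p.1 i : ℂ) + I * (p.2 i : ℂ))

/-- The lattice point `γ = (θ/√2)(m + i n)`. -/
def latticePoint (θ : ℝ) (γ : Label) : Phase :=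
  phasePoint θ (fun i => (γ.1 i : ℝ), fun i => (γ.2 i : ℝ))

/-- The scalar product `(φ, χ) = ∑_γ ⟨φ, χ U_γ⟩ U_{-γ}` with values in the noncommutative torus
`A_θ`, given by its coefficients: at `γ` stands the coefficient of `U_γ`. -/
def torusPairing (θ : ℝ) (φ χ : Phase → ℂ) : Label → ℂ :=
  fun γ => scalar θ φ (translation θ (latticePoint θ (-γ)) χ)

/-- The normalized trace `∑_γ a_γ U_γ ↦ a_0` on `A_θ`. -/
def torusTrace (a : Label → ℂ) : ℂ := a 0

/-! Kernels. The second argument of a two-point kernel, and the second and the fourth one of a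
four-point kernel, enter through their complex conjugates. -/

/-- The reproducing kernel `I(z, w̄) = exp(ω w̄·z)`. -/
def idKernel (θ : ℝ) (z w : Phase) : ℂ := cexp (freq θ * cdot w z)

/-- The kernel of `T_v`, `exp(-ω |v|²/2 - ω v̄·z) I(z + v, w̄)`. -/
def translationKernel (θ : ℝ) (v z w : Phase) : ℂ :=
  cexp (-(freq θ : ℂ) * nsq v / 2 - freq θ * cdot v z) * idKernel θ (z + v) w

/-- The integrand `exp(-β μ₀²/2) I(z, exp(-β ω) w̄)` of the propagator. -/
def heatKernel (θ μ₀ β : ℝ) (z w : Phase) : ℂ :=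
  (Real.exp (-β * μ₀ ^ 2 / 2) : ℂ) * idKernel θ z ((Real.exp (-β * freq θ) : ℂ) • w)

/-- The regularized propagator `(1/2) ∫_ε^∞ dβ exp(-β μ₀²/2) I(z, exp(-β ω) w̄)`, which is the
kernel of `(1/2) ∫_ε^∞ dβ exp(-β H/2) = H⁻¹ exp(-ε H/2)` for `H = 2 ω ∑ᵢ zᵢ ∂ᵢ + μ₀²`. -/
def propagator (θ μ₀ ε : ℝ) (z w : Phase) : ℂ :=
  1 / 2 * ∫ β in Set.Ioi ε, heatKernel θ μ₀ β z w

/-- The contribution of one vector `v` to the vertex: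
`(lam/2) U_v(z₁, z̄₂) U_{-v}(z₃, z̄₄)`. -/
def vertexMode (θ lam : ℝ) (v z₁ z₂ z₃ z₄ : Phase) : ℂ :=
  lam / 2 * (translationKernel θ v z₁ z₂ * translationKernel θ (-v) z₃ z₄)

/-- The quartic vertex, the sum of the contributions of all lattice vectors. -/
def vertex (θ lam : ℝ) (z₁ z₂ z₃ z₄ : Phase) : ℂ :=
  ∑' γ : Label, vertexMode θ lam (latticePoint θ γ) z₁ z₂ z₃ z₄

/-- The integrand, in `p = (z₃, z₄)`, of the graph with a closed scalar loop. -/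
def loopIntegrand (θ μ₀ ε : ℝ) (V : Phase → Phase → Phase → Phase → ℂ) (z₁ z₂ : Phase)
    (p : Phase × Phase) : ℂ :=
  V z₁ z₂ p.1 p.2 * propagator θ μ₀ ε p.2 p.1

/-- The one-loop two-point graph with a closed scalar loop,
`2 ∫ dμ(z₃) dμ(z₄) V(z₁, z̄₂, z₃, z̄₄) H_ε⁻¹(z₄, z̄₃)`, for a four-point kernel `V`. -/
def loopGraph (θ μ₀ ε : ℝ) (V : Phase → Phase → Phase → Phase → ℂ) (z₁ z₂ : Phase) : ℂ :=
  2 * ∫ p, loopIntegrand θ μ₀ ε V z₁ z₂ p ∂(gauss θ).prod (gauss θ)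

/-- The integrand, in `p = (z₃, z₄)`, of the graph without a closed scalar loop. -/
def lineIntegrand (θ μ₀ ε : ℝ) (V : Phase → Phase → Phase → Phase → ℂ) (z₁ z₂ : Phase)
    (p : Phase × Phase) : ℂ :=
  V z₁ p.2 p.1 z₂ * propagator θ μ₀ ε p.2 p.1

/-- The one-loop two-point graph without a closed scalar loop,
`2 ∫ dμ(z₃) dμ(z₄) V(z₁, z̄₄, z₃, z̄₂) H_ε⁻¹(z₄, z̄₃)`, for a four-point kernel `V`. -/
def lineGraph (θ μ₀ ε : ℝ) (V : Phase → Phase → Phase → Phase → ℂ) (z₁ z₂ : Phase) : ℂ :=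
  2 * ∫ p, lineIntegrand θ μ₀ ε V z₁ z₂ p ∂(gauss θ).prod (gauss θ)

/-- The regularized one-loop two-point 1PI function as a kernel: the sum of the two graphs. -/
def twoPoint (θ lam μ₀ ε : ℝ) (z₁ z₂ : Phase) : ℂ :=
  loopGraph θ μ₀ ε (vertex θ lam) z₁ z₂ + lineGraph θ μ₀ ε (vertex θ lam) z₁ z₂

/-- The integrand of a kernel `G` evaluated in the external fields `φ̄₁, φ₂`. -/
def smearIntegrand (G : Phase → Phase → ℂ) (φ₁ φ₂ : Phase → ℂ) (p : Phase × Phase) : ℂ :=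
  conj (φ₁ p.1) * φ₂ p.2 * G p.1 p.2

/-- The kernel `G` evaluated in the external fields,
`G[φ̄₁, φ₂] = ∫ dμ(z₁) dμ(z₂) φ̄₁(z̄₁) φ₂(z₂) G(z₁, z̄₂)`. -/
def smear (θ : ℝ) (G : Phase → Phase → ℂ) (φ₁ φ₂ : Phase → ℂ) : ℂ :=
  ∫ p, smearIntegrand G φ₁ φ₂ p ∂(gauss θ).prod (gauss θ)

/-- The contribution of the lattice vector `γ` to the graph with a closed loop. -/
def loopMode (θ lam μ₀ ε : ℝ) (γ : Label) (z₁ z₂ : Phase) : ℂ :=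
  loopGraph θ μ₀ ε (vertexMode θ lam (latticePoint θ γ)) z₁ z₂

/-- The integrand, in `p ∈ ℝ² × ℝ²`, of the Fourier transform that defines `dualMode`. -/
def dualIntegrand (θ lam μ₀ ε : ℝ) (k : Label) (z₁ z₂ : Phase)
    (p : (Fin 2 → ℝ) × (Fin 2 → ℝ)) : ℂ :=
  cexp (-(2 * Real.pi * I) * ∑ i, ((k.1 i : ℂ) * (p.1 i : ℂ) + (k.2 i : ℂ) * (p.2 i : ℂ))) *
    lineGraph θ μ₀ ε (vertexMode θ lam (phasePoint θ p)) z₁ z₂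

/-- The contribution of the dual lattice vector `γ* = (k₁ + i k₂)/√2` to the graph without a
closed loop, after Poisson resummation of the sum over the lattice: the Fourier coefficient at
`k = (k₁, k₂)` of the contribution of the vector `(θ/√2)(x + i y)`, as a function of
`(x, y) ∈ ℝ² × ℝ²`. -/
def dualMode (θ lam μ₀ ε : ℝ) (k : Label) (z₁ z₂ : Phase) : ℂ :=
  ∫ p, dualIntegrand θ lam μ₀ ε k z₁ z₂ p

/-- The singular function `1/(ε ω) + (1 - μ₀²/(2 ω)) ln(1/ε)` of the cut-off. -/
def singularFactor (θ μ₀ ε : ℝ) : ℝ :=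
  1 / (ε * freq θ) + (1 - μ₀ ^ 2 / (2 * freq θ)) * Real.log (1 / ε)

/-- All the series and integrals that enter the regularized two-point function in the external
fields `φ̄₁, φ₂`, and into its decomposition in modes, converge absolutely. -/
structure WellDefined (θ lam μ₀ ε : ℝ) (φ₁ φ₂ : Phase → ℂ) : Prop where
  propagator_conv : ∀ z w, IntegrableOn (fun β => heatKernel θ μ₀ β z w) (Set.Ioi ε)
  vertex_conv : ∀ z₁ z₂ z₃ z₄,
    Summable fun γ : Label => vertexMode θ lam (latticePoint θ γ) z₁ z₂ z₃ z₄
  loop_conv : ∀ z₁ z₂, Integrable (loopIntegrand θ μ₀ ε (vertex θ lam) z₁ z₂)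
    ((gauss θ).prod (gauss θ))
  line_conv : ∀ z₁ z₂, Integrable (lineIntegrand θ μ₀ ε (vertex θ lam) z₁ z₂)
    ((gauss θ).prod (gauss θ))
  loop_smear : Integrable (smearIntegrand (loopGraph θ μ₀ ε (vertex θ lam)) φ₁ φ₂)
    ((gauss θ).prod (gauss θ))
  line_smear : Integrable (smearIntegrand (lineGraph θ μ₀ ε (vertex θ lam)) φ₁ φ₂)
    ((gauss θ).prod (gauss θ))
  loop_mode : ∀ v z₁ z₂, Integrable (loopIntegrand θ μ₀ ε (vertexMode θ lam v) z₁ z₂)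
    ((gauss θ).prod (gauss θ))
  line_mode : ∀ v z₁ z₂, Integrable (lineIntegrand θ μ₀ ε (vertexMode θ lam v) z₁ z₂)
    ((gauss θ).prod (gauss θ))
  dual_mode : ∀ k z₁ z₂, Integrable (dualIntegrand θ lam μ₀ ε k z₁ z₂)
  loop_mode_smear : ∀ γ, Integrable (smearIntegrand (loopMode θ lam μ₀ ε γ) φ₁ φ₂)
    ((gauss θ).prod (gauss θ))
  dual_mode_smear : ∀ k, Integrable (smearIntegrand (dualMode θ lam μ₀ ε k) φ₁ φ₂)
    ((gauss θ).prod (gauss θ))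

/-- `F ε = ∑_γ F_γ ε` for `ε > 0`, where each `F_γ` with `γ ≠ 0` has a finite limit as
`ε → 0⁺`, and the sum over all `γ ≠ 0` converges absolutely and tends to the absolutely
convergent sum of these limits. -/
def OnlyZeroModeDiverges (F : ℝ → ℂ) (mode : Label → ℝ → ℂ) : Prop :=
  (∀ ε > 0, HasSum (fun γ => mode γ ε) (F ε)) ∧
    ∃ ℓ : Label → ℂ,
      (∀ γ, γ ≠ 0 → Tendsto (mode γ) (𝓝[>] 0) (𝓝 (ℓ γ))) ∧
      Summable (fun γ : {γ : Label // γ ≠ 0} => ℓ γ) ∧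
      Tendsto (fun ε => ∑' γ : {γ : Label // γ ≠ 0}, mode γ ε) (𝓝[>] 0)
        (𝓝 (∑' γ : {γ : Label // γ ≠ 0}, ℓ γ))

/-- `F` has the divergent part `D` as `ε → 0⁺`: the difference has a finite limit. -/
def HasDivergentPart (F D : ℝ → ℂ) : Prop :=
  ∃ ℓ : ℂ, Tendsto (fun ε => F ε - D ε) (𝓝[>] 0) (𝓝 ℓ)

end HeisenbergModule

end

open HeisenbergModule

/-!
Everything is diagonal in the translation operators `T_v`. Write `ω = freq θ`, `q = exp(-β ω)`.
Gaussian integration over the loop variables shows that the closed loop with the vertex mode `v` is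
the kernel of `T_v` times a number, the trace of `T_{-v}` against the propagator, while the other
graph with that mode is a proper-time integral of the kernel of `T_v exp(-β ω N) T_{-v}`, where `N`
is the number operator (`loopGraph_vertexMode`, `lineGraph_vertexMode`). As a function of `v` the
latter is a Gaussian, and its Fourier coefficient at `k` is again the kernel of a translation
`T_{v'}`, `v' = dualPoint k`, with `θ⁻²` times the number that belongs to `v'` in the closed loop
(`integral_fourier_conjugatedHeat`); Poisson summation in each of the four lattice coordinates,
at fixed `β`, resums it (`hasSum_dualHeat`). Both graphs are therefore sums of the same shape,
`∑ A c(|v|², ε) T_v` with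
`c(s, ε) = ½ ∫_ε^∞ exp(-β μ₀²/2) (1 - q)⁻² exp(-(ω/2) s (1 + q)/(1 - q)) dβ`
(`hasSum_loopGraph`, `hasSum_lineGraph`), and one argument treats both.

For `s > 0` the last exponential suppresses the singularity at `β = 0`, so that `c(s, ε)` converges
as `ε → 0⁺` and is bounded by a multiple of `exp(-ω s/4)` uniformly in `ε` (`modeCoeff_le`). For
`s = 0` the expansion of the integrand at `β = 0` produces the terms `1/ε` and `ln(1/ε)`
(`tendsto_modeCoeff_zero_sub`). The kernel of `T_v` is bounded by
`exp(ω |z|²/2) exp(ω |w|²/2)` uniformly in `v`, so dominated convergence carries these facts over to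
the smeared graphs (`onlyZeroModeDiverges_of_modes`) as soon as `exp(-ω |z|²/2) φ(z)` is integrable
for the external fields. That holds because multiplication by `z i` is, under the Bargmann
transform, a first-order differential operator that preserves the Schwartz space, whence decay
faster than any power (`exists_bargmann_decay`). Finally `T_0` is the identity, whose kernel
reproduces the smooth module, and this turns the zero mode into the trace of the pairing
(`smear_translationKernel_zero`).

Absolute convergence of the graphs with the full vertex comes from the strict inequality `q < 1`
above the cut-off: the loop integrands are dominated by
`exp(-c |v|²) exp(ω (1 - t) (|z₃|² + |z₄|²))` with `c, t > 0`, see `GaussianVertex`.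
-/

namespace HeisenbergModule

/-! ### Gaussian integrals -/

lemma integrable_cexp_planar_gaussian_real {A s : ℝ} (h₁ : 0 < A - s) (h₂ : 0 < A + s)
    (b c : ℂ) :
    Integrable (fun p : ℝ × ℝ => cexp (-((A + s : ℝ) : ℂ) * p.2 ^ 2
      + (2 * I * s * p.1 + I * (b - c)) * p.2) * cexp (-((A - s : ℝ) : ℂ) * p.1 ^ 2
      + (b + c) * p.1)) := by
  have hf := integrable_cexp_quadratic (b := ((A - s : ℝ) : ℂ)) (by simpa using h₁) (b + c) 0
  have hg := integrable_cexp_quadratic (b := ((A + s : ℝ) : ℂ)) (by rwa [ofReal_re])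
    (I * (b - c)) 0
  have hfg := hf.mul_prod hg
  refine (hfg.bdd_mul (c := 1)
    (f := fun p : ℝ × ℝ => cexp ((2 * s * p.1 * p.2 : ℝ) * I)) ?_ ?_).congr ?_
  · exact Continuous.aestronglyMeasurable (by fun_prop)
  · exact Eventually.of_forall fun p => (norm_exp_ofReal_mul_I _).le
  · refine Eventually.of_forall fun p => ?_
    simp only [← Complex.exp_add]
    congr 1
    push_cast
    ring

/-- The planar Gaussian with a holomorphic quadratic term `s z²`, in real coordinates: the term
`s z²` couples the two coordinates, which are integrated one after the other. -/
lemma integral_cexp_planar_gaussian_real {A s : ℝ} (h₁ : 0 < A - s) (h₂ : 0 < A + s)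
    (b c : ℂ) :
    ∫ p : ℝ × ℝ, cexp (-((A + s : ℝ) : ℂ) * p.2 ^ 2
      + (2 * I * s * p.1 + I * (b - c)) * p.2) * cexp (-((A - s : ℝ) : ℂ) * p.1 ^ 2
      + (b + c) * p.1) = Real.pi / A * cexp (b * c / A + s * c ^ 2 / A ^ 2) := by
  have hA : 0 < A := by linarith
  have hA' : (A : ℂ) ≠ 0 := by exact_mod_cast hA.ne'
  have hAs : (A : ℂ) + s ≠ 0 := by exact_mod_cast h₂.ne'
  -- The integral over `y` shifts the quadratic coefficient in `x` from `A - s` to `A² / (A + s)`.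
  rw [Measure.volume_eq_prod, integral_prod _ (integrable_cexp_planar_gaussian_real h₁ h₂ b c)]
  have inner : ∀ x : ℝ, (∫ y : ℝ, cexp (-((A + s : ℝ) : ℂ) * y ^ 2
      + (2 * I * s * x + I * (b - c)) * y) * cexp (-((A - s : ℝ) : ℂ) * x ^ 2
      + (b + c) * x)) = (Real.pi / (A + s : ℝ) : ℂ) ^ (1 / 2 : ℂ) *
      cexp (-((A ^ 2 / (A + s) : ℝ) : ℂ) * x ^ 2 +
        ((b + c) - s * (b - c) / (A + s)) * x + - (b - c) ^ 2 / (4 * (A + s))) := by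
    intro x
    rw [integral_mul_const]
    have := integral_cexp_quadratic (b := -((A + s : ℝ) : ℂ))
      (by rw [neg_re, ofReal_re]; linarith)
      (2 * I * s * x + I * (b - c)) 0
    simp only [add_zero] at this
    rw [this, neg_neg, mul_assoc, ← Complex.exp_add]
    congr 2
    push_cast
    have hI : I ^ 2 = -1 := I_sq
    field_simp
    ring_nf
    simp only [hI]
    ring
  simp only [inner]
  have hAA : 0 < A ^ 2 / (A + s) := by positivity
  rw [integral_const_mul, integral_cexp_quadratic (b := -((A ^ 2 / (A + s) : ℝ) : ℂ))
    (by rw [neg_re, ofReal_re]; linarith), neg_neg, ← mul_assoc]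
  congr 1
  · have e : ∀ t : ℝ, 0 < t → ((Real.pi / t : ℂ)) ^ (1 / 2 : ℂ) = (Real.sqrt (Real.pi / t) : ℂ) := by
      intro t ht
      rw [Real.sqrt_eq_rpow, ofReal_cpow (by positivity)]
      push_cast; rfl
    rw [e _ h₂, e _ hAA, ← ofReal_mul, ← Real.sqrt_mul (by positivity)]
    rw [show Real.pi / (A + s) * (Real.pi / (A ^ 2 / (A + s))) = (Real.pi / A) ^ 2 by
      field_simp]
    rw [Real.sqrt_sq (by positivity)]
    push_cast; rfl
  · congr 1
    push_cast
    field_simp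
    ring

lemma cexp_gaussian_measurableEquivRealProd_symm (A s : ℝ) (b c : ℂ) (p : ℝ × ℝ) :
    cexp (-A * (‖measurableEquivRealProd.symm p‖ ^ 2 : ℝ)
      + s * (measurableEquivRealProd.symm p) ^ 2 + b * (measurableEquivRealProd.symm p)
      + c * conj (measurableEquivRealProd.symm p)) =
    cexp (-((A + s : ℝ) : ℂ) * p.2 ^ 2
      + (2 * I * s * p.1 + I * (b - c)) * p.2) * cexp (-((A - s : ℝ) : ℂ) * p.1 ^ 2
      + (b + c) * p.1) := by
  rw [← Complex.exp_add]
  congr 1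
  have h : measurableEquivRealProd.symm p = (p.1 : ℂ) + p.2 * I := by
    rw [measurableEquivRealProd_symm_apply, Complex.mk_eq_add_mul_I]
  rw [h, ← Complex.normSq_eq_norm_sq, Complex.normSq_add_mul_I]
  simp only [map_add, map_mul, conj_ofReal, conj_I]
  push_cast
  have hI : I ^ 2 = -1 := I_sq
  ring_nf
  simp only [hI]
  ring

lemma integrable_cexp_gaussian {A s : ℝ} (h₁ : 0 < A - s) (h₂ : 0 < A + s) (b c : ℂ) :
    Integrable fun z : ℂ => cexp (-A * (‖z‖ ^ 2 : ℝ) + s * z ^ 2 + b * z + c * conj z) := by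
  rw [← volume_preserving_equiv_real_prod.symm.integrable_comp_emb
    measurableEquivRealProd.symm.measurableEmbedding]
  simpa only [Function.comp_def, cexp_gaussian_measurableEquivRealProd_symm] using
    integrable_cexp_planar_gaussian_real h₁ h₂ b c

lemma integral_cexp_gaussian {A s : ℝ} (h₁ : 0 < A - s) (h₂ : 0 < A + s) (b c : ℂ) :
    ∫ z : ℂ, cexp (-A * (‖z‖ ^ 2 : ℝ) + s * z ^ 2 + b * z + c * conj z)
      = Real.pi / A * cexp (b * c / A + s * c ^ 2 / A ^ 2) := by
  rw [← volume_preserving_equiv_real_prod.symm.integral_comp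
    measurableEquivRealProd.symm.measurableEmbedding]
  simpa only [cexp_gaussian_measurableEquivRealProd_symm] using
    integral_cexp_planar_gaussian_real h₁ h₂ b c

lemma integral_cexp_gaussian_phase {A s : ℝ} (h₁ : 0 < A - s) (h₂ : 0 < A + s) (b c : Phase) :
    ∫ z : Phase, cexp (-A * nsq z + s * ∑ i, z i ^ 2 + ∑ i, b i * z i + ∑ i, c i * conj (z i))
      = (Real.pi / A) ^ 2 * cexp ((∑ i, b i * c i) / A + s * (∑ i, c i ^ 2) / A ^ 2) := by
  have := integral_fintype_prod_volume_eq_prod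
    (fun (i : Fin 2) (z : ℂ) => cexp (-A * (‖z‖ ^ 2 : ℝ) + s * z ^ 2 + b i * z + c i * conj z))
  simp only [integral_cexp_gaussian h₁ h₂] at this
  simp only [Fin.prod_univ_two, ← Complex.exp_add] at this
  convert! this using 1
  · refine integral_congr_ae (Eventually.of_forall fun z => ?_)
    simp only [nsq, Fin.sum_univ_two]
    congr 1
    push_cast
    ring
  · simp only [Fin.sum_univ_two]
    rw [mul_mul_mul_comm, ← Complex.exp_add, ← sq]
    congr 2
    ring

lemma integrable_exp_nsq {A : ℝ} (hA : 0 < A) :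
    Integrable fun z : Phase => Real.exp (-A * nsq z) := by
  have h := (integrable_cexp_gaussian (A := A) (s := 0) (by simpa) (by simpa) 0 0).norm
  have := Integrable.fintype_prod (f := fun (_ : Fin 2) => fun z : ℂ => _) (fun _ => h)
  refine this.congr (Eventually.of_forall fun z => ?_)
  simp only [Fin.prod_univ_two, Complex.norm_exp, nsq, Fin.sum_univ_two, ← Real.exp_add]
  congr 1
  simp only [ofReal_zero, zero_mul, add_zero, ← ofReal_neg, ← ofReal_mul, ofReal_re]
  ring

/-! ### The Gaussian measure -/

lemma freq_pos {θ : ℝ} (hθ : 0 < θ) : 0 < freq θ := by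
  unfold freq; positivity

@[fun_prop]
lemma continuous_nsq : Continuous nsq := by unfold nsq; fun_prop

lemma nsq_nonneg (z : Phase) : 0 ≤ nsq z := by unfold nsq; positivity

lemma gauss_eq (θ : ℝ) : gauss θ = volume.withDensity fun z =>
    ((Real.toNNReal ((freq θ / Real.pi) ^ 2 * Real.exp (-freq θ * nsq z)) : NNReal) : ENNReal) :=
  rfl

lemma measurable_gauss_density (θ : ℝ) : Measurable fun z : Phase =>
    Real.toNNReal ((freq θ / Real.pi) ^ 2 * Real.exp (-freq θ * nsq z)) := by
  apply Measurable.real_toNNReal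
  exact Continuous.measurable (by fun_prop)

lemma integrable_gauss_iff {θ : ℝ} (hθ : 0 < θ) {E : Type*} [NormedAddCommGroup E]
    [NormedSpace ℝ E] (f : Phase → E) :
    Integrable f (gauss θ) ↔ Integrable fun z => Real.exp (-freq θ * nsq z) • f z := by
  have hω := freq_pos hθ
  rw [gauss_eq, integrable_withDensity_iff_integrable_smul (measurable_gauss_density θ)]
  rw [← integrable_smul_iff (c := (freq θ / Real.pi) ^ 2) (by positivity)
    (fun z => Real.exp (-freq θ * nsq z) • f z)]
  refine integrable_congr (Eventually.of_forall fun z => ?_)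
  simp only [NNReal.smul_def, Pi.smul_apply, smul_smul]
  rw [Real.coe_toNNReal _ (by positivity)]

lemma integral_gauss {θ : ℝ} {E : Type*} [NormedAddCommGroup E]
    [NormedSpace ℝ E] (f : Phase → E) :
    ∫ z, f z ∂gauss θ = (freq θ / Real.pi) ^ 2 • ∫ z, Real.exp (-freq θ * nsq z) • f z := by
  rw [gauss_eq, integral_withDensity_eq_integral_smul (measurable_gauss_density θ),
    ← integral_smul]
  refine integral_congr_ae (Eventually.of_forall fun z => ?_)
  simp only [NNReal.smul_def, smul_smul]
  rw [Real.coe_toNNReal _ (by positivity)]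

lemma integrable_gauss_exp_nsq {θ a : ℝ} (hθ : 0 < θ) (ha : a < freq θ) :
    Integrable (fun z => Real.exp (a * nsq z)) (gauss θ) := by
  rw [integrable_gauss_iff hθ]
  refine (integrable_exp_nsq (A := freq θ - a) (by linarith)).congr
    (Eventually.of_forall fun z => ?_)
  simp only [smul_eq_mul, ← Real.exp_add]
  congr 1; ring

instance (θ : ℝ) : SigmaFinite (gauss θ) := by
  rw [gauss_eq]
  exact SigmaFinite.withDensity_of_ne_top' (by simp)

/-- Gaussian integrals against `gauss θ`, with the weight `exp(-ω |z|²)` weakened to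
`exp(-ω A |z|²)` and with a holomorphic quadratic term. -/
lemma integral_gauss_cexp {θ A s : ℝ} (hθ : 0 < θ) (h₁ : 0 < A - s) (h₂ : 0 < A + s)
    (b c : Phase) :
    ∫ z, cexp (freq θ * ((1 - A) * nsq z + s * ∑ i, z i ^ 2 + ∑ i, b i * z i
      + ∑ i, c i * conj (z i))) ∂gauss θ
      = 1 / A ^ 2 * cexp (freq θ * ((∑ i, b i * c i) / A + s * (∑ i, c i ^ 2) / A ^ 2)) := by
  have hω := freq_pos hθ
  have hω' : (freq θ : ℂ) ≠ 0 := by exact_mod_cast hω.ne'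
  have hA : (A : ℂ) ≠ 0 := by
    have : 0 < A := by linarith
    exact_mod_cast this.ne'
  have hπ : (Real.pi : ℂ) ≠ 0 := by exact_mod_cast Real.pi_ne_zero
  have key := integral_cexp_gaussian_phase (A := freq θ * A) (s := freq θ * s)
    (by rw [← mul_sub]; positivity) (by rw [← mul_add]; positivity)
    (fun i => freq θ * b i) (fun i => freq θ * c i)
  rw [integral_gauss]
  have e : ∀ z : Phase, Real.exp (-freq θ * nsq z) • cexp (freq θ * ((1 - A) * nsq z
      + s * ∑ i, z i ^ 2 + ∑ i, b i * z i + ∑ i, c i * conj (z i))) =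
      cexp (-(freq θ * A : ℝ) * nsq z + (freq θ * s : ℝ) * ∑ i, z i ^ 2
        + ∑ i, freq θ * b i * z i + ∑ i, freq θ * c i * conj (z i)) := by
    intro z
    rw [real_smul, ofReal_exp, ← Complex.exp_add]
    congr 1
    simp only [Fin.sum_univ_two]
    push_cast
    ring
  simp only [e, key, real_smul]
  rw [← mul_assoc]
  congr 1
  · push_cast; field_simp
  · congr 1
    simp only [Fin.sum_univ_two]
    push_cast; field_simp

/-! ### Pointwise bounds on the kernels -/

lemma ofReal_nsq (z : Phase) : (nsq z : ℂ) = ∑ i, conj (z i) * z i := by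
  simp [nsq, Complex.conj_mul']

lemma nsq_eq_re_im (z : Phase) : nsq z = ∑ i, ((z i).re ^ 2 + (z i).im ^ 2) := by
  simp only [nsq, ← Complex.normSq_eq_norm_sq, Complex.normSq_apply]
  exact Finset.sum_congr rfl fun i _ => by ring

lemma cdot_re (w z : Phase) :
    (cdot w z).re = ∑ i, ((w i).re * (z i).re + (w i).im * (z i).im) := by
  simp [cdot]

/-- The kernel of a translation, divided by the Gaussian weights of its two arguments, is bounded
uniformly in the translation vector. -/
lemma norm_translationKernel (θ : ℝ) (v z w : Phase) :
    ‖translationKernel θ v z w‖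
      = Real.exp (freq θ / 2 * (nsq z + nsq w - nsq (z - w + v))) := by
  rw [translationKernel, idKernel, ← Complex.exp_add, Complex.norm_exp]
  congr 1
  rw [add_re, sub_re, re_ofReal_mul, re_ofReal_mul]
  rw [show (-(freq θ : ℂ) * nsq v / 2).re = -freq θ * nsq v / 2 by
    rw [← ofReal_neg, ← ofReal_mul]; norm_cast]
  simp only [cdot_re, nsq_eq_re_im, Fin.sum_univ_two, Pi.add_apply, Pi.sub_apply, add_re, add_im,
    sub_re, sub_im]
  ring

lemma norm_translationKernel_le {θ : ℝ} (hθ : 0 < θ) (v z w : Phase) :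
    ‖translationKernel θ v z w‖ ≤ Real.exp (freq θ / 2 * nsq z) * Real.exp (freq θ / 2 * nsq w) := by
  have hω := freq_pos hθ
  rw [norm_translationKernel, ← Real.exp_add, Real.exp_le_exp]
  nlinarith [mul_nonneg hω.le (nsq_nonneg (z - w + v))]

lemma cdot_smul_left (q : ℝ) (w z : Phase) : cdot ((q : ℂ) • w) z = q * cdot w z := by
  simp [cdot, mul_assoc, mul_add]

lemma idKernel_smul (θ q : ℝ) (z w : Phase) :
    idKernel θ z ((q : ℂ) • w) = cexp (freq θ * (q * cdot w z)) := by
  rw [idKernel, cdot_smul_left]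

lemma norm_idKernel_smul_le {θ q q₀ : ℝ} (hθ : 0 < θ) (hq : 0 ≤ q) (hqq : q ≤ q₀) (z w : Phase) :
    ‖idKernel θ z ((q : ℂ) • w)‖
      ≤ Real.exp (freq θ * (q₀ / 2) * nsq w) * Real.exp (freq θ * (q₀ / 2) * nsq z) := by
  have hω := freq_pos hθ
  rw [idKernel_smul, Complex.norm_exp, ← Real.exp_add, Real.exp_le_exp, re_ofReal_mul,
    re_ofReal_mul]
  have h1 : (cdot w z).re ≤ (nsq w + nsq z) / 2 := by
    simp only [cdot_re, nsq_eq_re_im, Fin.sum_univ_two]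
    nlinarith [sq_nonneg ((w 0).re - (z 0).re), sq_nonneg ((w 0).im - (z 0).im),
      sq_nonneg ((w 1).re - (z 1).re), sq_nonneg ((w 1).im - (z 1).im)]
  have h2 : q * (cdot w z).re ≤ q₀ * ((nsq w + nsq z) / 2) :=
    (mul_le_mul_of_nonneg_left h1 hq).trans
      (mul_le_mul_of_nonneg_right hqq (by linarith [nsq_nonneg w, nsq_nonneg z]))
  nlinarith [mul_le_mul_of_nonneg_left h2 hω.le]

lemma norm_heatKernel_le {θ ε β : ℝ} (hθ : 0 < θ) (μ₀ : ℝ) (hβ : ε ≤ β) (z w : Phase) :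
    ‖heatKernel θ μ₀ β z w‖ ≤ Real.exp (-(μ₀ ^ 2 / 2) * β) *
      (Real.exp (freq θ * (Real.exp (-ε * freq θ) / 2) * nsq w) *
        Real.exp (freq θ * (Real.exp (-ε * freq θ) / 2) * nsq z)) := by
  have hω := freq_pos hθ
  rw [heatKernel, norm_mul, norm_real, Real.norm_of_nonneg (Real.exp_pos _).le]
  rw [show -β * μ₀ ^ 2 / 2 = -(μ₀ ^ 2 / 2) * β by ring]
  gcongr
  refine norm_idKernel_smul_le hθ (Real.exp_pos _).le ?_ z w
  rw [Real.exp_le_exp]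
  nlinarith

lemma continuous_heatKernel (θ μ₀ : ℝ) :
    Continuous fun x : (Phase × Phase) × ℝ => heatKernel θ μ₀ x.2 x.1.2 x.1.1 := by
  unfold heatKernel idKernel cdot
  fun_prop

lemma integrableOn_exp_mass {μ₀ : ℝ} (hμ₀ : μ₀ ≠ 0) (ε : ℝ) :
    IntegrableOn (fun β => Real.exp (-(μ₀ ^ 2 / 2) * β)) (Set.Ioi ε) :=
  integrableOn_exp_mul_Ioi (by have := sq_pos_of_ne_zero hμ₀; linarith) ε

lemma integrableOn_heatKernel {θ μ₀ ε : ℝ} (hθ : 0 < θ) (hμ₀ : μ₀ ≠ 0) (z w : Phase) :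
    IntegrableOn (fun β => heatKernel θ μ₀ β z w) (Set.Ioi ε) := by
  refine Integrable.mono' ((integrableOn_exp_mass hμ₀ ε).mul_const _) ?_
    ((ae_restrict_iff' measurableSet_Ioi).2 (Eventually.of_forall fun β hβ =>
      norm_heatKernel_le hθ μ₀ (le_of_lt hβ) z w))
  exact ((continuous_heatKernel θ μ₀).comp (g := fun x : (Phase × Phase) × ℝ => _)
    (f := fun β : ℝ => ((w, z), β)) (by fun_prop)).aestronglyMeasurable

lemma norm_propagator_le {θ μ₀ ε : ℝ} (hθ : 0 < θ) (hμ₀ : μ₀ ≠ 0) (z w : Phase) :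
    ‖propagator θ μ₀ ε z w‖ ≤ (∫ β in Set.Ioi ε, Real.exp (-(μ₀ ^ 2 / 2) * β)) *
      (Real.exp (freq θ * (Real.exp (-ε * freq θ) / 2) * nsq w) *
        Real.exp (freq θ * (Real.exp (-ε * freq θ) / 2) * nsq z)) := by
  rw [propagator, norm_mul, ← integral_mul_const]
  have h := norm_integral_le_of_norm_le ((integrableOn_exp_mass hμ₀ ε).mul_const _)
    ((ae_restrict_iff' measurableSet_Ioi).2 (Eventually.of_forall fun β hβ =>
      norm_heatKernel_le hθ μ₀ (le_of_lt hβ) z w))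
  refine le_trans ?_ h
  refine mul_le_of_le_one_left (norm_nonneg _) (by norm_num)

lemma stronglyMeasurable_propagator (θ μ₀ ε : ℝ) :
    StronglyMeasurable fun p : Phase × Phase => propagator θ μ₀ ε p.2 p.1 := by
  unfold propagator
  exact ((continuous_heatKernel θ μ₀).stronglyMeasurable.integral_prod_right).const_mul _

/-! ### Graphs with a Gaussian bound on the vertex -/

/-- A four-point kernel `W v`, with two of its arguments fixed and depending on a vector `v`, that
is Gaussian in `v` and whose growth in the two loop variables `p` exceeds the square root
`exp(ω |z|²/2)` of the weight of `gauss θ` by an arbitrarily small amount, measured by `t`. -/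
structure GaussianVertex (θ t C : ℝ) (W : Phase → Phase × Phase → ℂ) : Prop where
  cont : Continuous fun x : Phase × (Phase × Phase) => W x.1 x.2
  bound : ∀ v p, ‖W v p‖ ≤ C * Real.exp (-(freq θ * t / 4) * nsq v) *
    (Real.exp (freq θ * (1 / 2 + t) * nsq p.1) * Real.exp (freq θ * (1 / 2 + t) * nsq p.2))

/-- The rate of the Gaussian decay of the vertices that the cut-off `ε` leaves room for. -/
noncomputable def decayRate (θ ε : ℝ) : ℝ := (1 - Real.exp (-ε * freq θ)) / 4

/-- The integrable weight in the loop variables that dominates a vertex times the propagator. -/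
noncomputable def loopWeight (θ ε : ℝ) (p : Phase × Phase) : ℝ :=
  Real.exp (freq θ * (1 - decayRate θ ε) * nsq p.1) *
    Real.exp (freq θ * (1 - decayRate θ ε) * nsq p.2)

section
variable {θ ε : ℝ}

lemma exp_cutoff_lt_one (hθ : 0 < θ) (hε : 0 < ε) : Real.exp (-ε * freq θ) < 1 := by
  have := freq_pos hθ
  rw [Real.exp_lt_one_iff]
  nlinarith

lemma decayRate_pos (hθ : 0 < θ) (hε : 0 < ε) : 0 < decayRate θ ε := by
  have := exp_cutoff_lt_one hθ hε
  unfold decayRate; linarith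

lemma decayRate_le_one : decayRate θ ε ≤ 1 := by
  have := Real.exp_pos (-ε * freq θ)
  unfold decayRate; linarith

lemma integrable_loopWeight (hθ : 0 < θ) (hε : 0 < ε) :
    Integrable (loopWeight θ ε) ((gauss θ).prod (gauss θ)) := by
  have hω := freq_pos hθ
  have ht := decayRate_pos hθ hε
  have : freq θ * (1 - decayRate θ ε) < freq θ := by nlinarith
  exact (integrable_gauss_exp_nsq hθ this).mul_prod (integrable_gauss_exp_nsq hθ this)

lemma loopWeight_eq (p : Phase × Phase) :
    (Real.exp (freq θ * (1 / 2 + decayRate θ ε) * nsq p.1) *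
      Real.exp (freq θ * (1 / 2 + decayRate θ ε) * nsq p.2)) *
      (Real.exp (freq θ * (Real.exp (-ε * freq θ) / 2) * nsq p.1) *
        Real.exp (freq θ * (Real.exp (-ε * freq θ) / 2) * nsq p.2)) = loopWeight θ ε p := by
  rw [mul_mul_mul_comm, ← Real.exp_add, ← Real.exp_add, loopWeight]
  congr 2 <;> (unfold decayRate; ring)

variable {C : ℝ} {W : Phase → Phase × Phase → ℂ}

namespace GaussianVertex

lemma norm_mul_heatKernel_le (h : GaussianVertex θ (decayRate θ ε) C W) (hθ : 0 < θ)
    (μ₀ : ℝ) {β : ℝ} (hβ : ε ≤ β) (v : Phase) (p : Phase × Phase) :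
    ‖W v p * heatKernel θ μ₀ β p.2 p.1‖ ≤
      C * Real.exp (-(freq θ * decayRate θ ε / 4) * nsq v) * Real.exp (-(μ₀ ^ 2 / 2) * β) *
        loopWeight θ ε p := by
  rw [norm_mul]
  refine (mul_le_mul (h.bound v p) (norm_heatKernel_le hθ μ₀ hβ p.2 p.1) (norm_nonneg _)
    ((norm_nonneg _).trans (h.bound v p))).trans_eq ?_
  rw [← loopWeight_eq]
  ring

lemma norm_mul_propagator_le (h : GaussianVertex θ (decayRate θ ε) C W) (hθ : 0 < θ)
    {μ₀ : ℝ} (hμ₀ : μ₀ ≠ 0) (v : Phase) (p : Phase × Phase) :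
    ‖W v p * propagator θ μ₀ ε p.2 p.1‖ ≤
      Real.exp (-(freq θ * decayRate θ ε / 4) * nsq v) *
        (C * (∫ β in Set.Ioi ε, Real.exp (-(μ₀ ^ 2 / 2) * β)) * loopWeight θ ε p) := by
  rw [norm_mul]
  refine (mul_le_mul (h.bound v p) (norm_propagator_le hθ hμ₀ p.2 p.1) (norm_nonneg _)
    ((norm_nonneg _).trans (h.bound v p))).trans_eq ?_
  rw [← loopWeight_eq]
  ring

lemma continuous_apply (h : GaussianVertex θ (decayRate θ ε) C W) (v : Phase) :
    Continuous (W v) :=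
  h.cont.comp (g := fun x : Phase × (Phase × Phase) => W x.1 x.2)
    (f := fun p => (v, p)) (by fun_prop)

lemma integrable_prod (h : GaussianVertex θ (decayRate θ ε) C W) (hθ : 0 < θ) (hε : 0 < ε)
    {μ₀ : ℝ} (hμ₀ : μ₀ ≠ 0) (v : Phase) :
    Integrable (fun x : (Phase × Phase) × ℝ => W v x.1 * heatKernel θ μ₀ x.2 x.1.2 x.1.1)
      (((gauss θ).prod (gauss θ)).prod (volume.restrict (Set.Ioi ε))) := by
  refine Integrable.mono' (((integrable_loopWeight hθ hε).const_mul
    (C * Real.exp (-(freq θ * decayRate θ ε / 4) * nsq v))).mul_prod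
      (integrableOn_exp_mass hμ₀ ε)) ?_ ?_
  · exact (((h.continuous_apply v).comp continuous_fst).mul
      (continuous_heatKernel θ μ₀)).aestronglyMeasurable
  · have : ∀ᵐ x : (Phase × Phase) × ℝ ∂(((gauss θ).prod (gauss θ)).prod
        (volume.restrict (Set.Ioi ε))), x.2 ∈ Set.Ioi ε :=
      Measure.quasiMeasurePreserving_snd.ae (ae_restrict_mem measurableSet_Ioi)
    filter_upwards [this] with x hx
    refine (h.norm_mul_heatKernel_le hθ μ₀ (le_of_lt hx) v x.1).trans_eq ?_
    ring

lemma integrable_heatKernel (h : GaussianVertex θ (decayRate θ ε) C W) (hθ : 0 < θ)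
    (hε : 0 < ε) (μ₀ : ℝ) {β : ℝ} (hβ : ε ≤ β) (v : Phase) :
    Integrable (fun p => W v p * heatKernel θ μ₀ β p.2 p.1) ((gauss θ).prod (gauss θ)) := by
  refine Integrable.mono' ((integrable_loopWeight hθ hε).const_mul _) ?_
    (Eventually.of_forall fun p => h.norm_mul_heatKernel_le hθ μ₀ hβ v p)
  exact ((h.continuous_apply v).mul ((continuous_heatKernel θ μ₀).comp
    (g := fun x : (Phase × Phase) × ℝ => heatKernel θ μ₀ x.2 x.1.2 x.1.1)
    (f := fun p => (p, β)) (by fun_prop))).aestronglyMeasurable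

lemma norm_integral_heatKernel_le (h : GaussianVertex θ (decayRate θ ε) C W) (hθ : 0 < θ)
    (hε : 0 < ε) (μ₀ : ℝ) {β : ℝ} (hβ : ε ≤ β) (v : Phase) :
    ‖∫ p, W v p * heatKernel θ μ₀ β p.2 p.1 ∂(gauss θ).prod (gauss θ)‖ ≤
      Real.exp (-(freq θ * decayRate θ ε / 4) * nsq v) * (Real.exp (-(μ₀ ^ 2 / 2) * β) *
        (C * ∫ p, loopWeight θ ε p ∂(gauss θ).prod (gauss θ))) := by
  refine (norm_integral_le_of_norm_le ((integrable_loopWeight hθ hε).const_mul _)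
    (Eventually.of_forall fun p => h.norm_mul_heatKernel_le hθ μ₀ hβ v p)).trans_eq ?_
  rw [integral_const_mul]
  ring

lemma integrable_propagator (h : GaussianVertex θ (decayRate θ ε) C W) (hθ : 0 < θ)
    (hε : 0 < ε) {μ₀ : ℝ} (hμ₀ : μ₀ ≠ 0) (v : Phase) :
    Integrable (fun p => W v p * propagator θ μ₀ ε p.2 p.1) ((gauss θ).prod (gauss θ)) :=
  Integrable.mono' (((integrable_loopWeight hθ hε).const_mul _).const_mul _)
    ((h.continuous_apply v).aestronglyMeasurable.mul
      (stronglyMeasurable_propagator θ μ₀ ε).aestronglyMeasurable)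
    (Eventually.of_forall fun p => h.norm_mul_propagator_le hθ hμ₀ v p)

lemma integral_propagator (h : GaussianVertex θ (decayRate θ ε) C W) (hθ : 0 < θ)
    (hε : 0 < ε) {μ₀ : ℝ} (hμ₀ : μ₀ ≠ 0) (v : Phase) :
    ∫ p, W v p * propagator θ μ₀ ε p.2 p.1 ∂(gauss θ).prod (gauss θ) =
      1 / 2 * ∫ β in Set.Ioi ε,
        ∫ p, W v p * heatKernel θ μ₀ β p.2 p.1 ∂(gauss θ).prod (gauss θ) := by
  rw [← integral_integral_swap (h.integrable_prod hθ hε hμ₀ v), ← integral_const_mul]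
  refine integral_congr_ae (Eventually.of_forall fun p => ?_)
  simp only [propagator, integral_const_mul]
  ring

lemma summable_apply {ι : Type*} {v : ι → Phase}
    (h : GaussianVertex θ (decayRate θ ε) C W)
    (hv : Summable fun γ => Real.exp (-(freq θ * decayRate θ ε / 4) * nsq (v γ)))
    (p : Phase × Phase) : Summable fun γ => W (v γ) p :=
  Summable.of_norm_bounded ((hv.mul_left C).mul_right _) fun γ => h.bound (v γ) p

variable {ι : Type*} [Countable ι] {v : ι → Phase}

lemma integrable_tsum (h : GaussianVertex θ (decayRate θ ε) C W) (hθ : 0 < θ)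
    (hε : 0 < ε) {μ₀ : ℝ} (hμ₀ : μ₀ ≠ 0)
    (hv : Summable fun γ => Real.exp (-(freq θ * decayRate θ ε / 4) * nsq (v γ))) :
    Integrable (fun p => (∑' γ, W (v γ) p) * propagator θ μ₀ ε p.2 p.1)
      ((gauss θ).prod (gauss θ)) := by
  refine Integrable.mono' (((integrable_loopWeight hθ hε).const_mul
    (C * (∫ β in Set.Ioi ε, Real.exp (-(μ₀ ^ 2 / 2) * β)))).const_mul
    (∑' γ, Real.exp (-(freq θ * decayRate θ ε / 4) * nsq (v γ)))) ?_ ?_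
  · refine AEStronglyMeasurable.mul ?_ (stronglyMeasurable_propagator θ μ₀ ε).aestronglyMeasurable
    refine aestronglyMeasurable_of_tendsto_ae atTop (f := fun s p => ∑ γ ∈ s, W (v γ) p) ?_ ?_
    · exact fun s => (continuous_finsetSum s fun γ _ =>
        h.continuous_apply (v γ)).aestronglyMeasurable
    · exact Eventually.of_forall fun p => (h.summable_apply hv p).hasSum
  · refine Eventually.of_forall fun p => ?_
    rw [← tsum_mul_right, ← tsum_mul_right]
    exact tsum_of_norm_bounded (hv.mul_right _).hasSum
      fun γ => h.norm_mul_propagator_le hθ hμ₀ (v γ) p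

lemma hasSum_integral (h : GaussianVertex θ (decayRate θ ε) C W) (hθ : 0 < θ)
    (hε : 0 < ε) {μ₀ : ℝ} (hμ₀ : μ₀ ≠ 0)
    (hv : Summable fun γ => Real.exp (-(freq θ * decayRate θ ε / 4) * nsq (v γ))) :
    HasSum (fun γ => ∫ p, W (v γ) p * propagator θ μ₀ ε p.2 p.1 ∂(gauss θ).prod (gauss θ))
      (∫ p, (∑' γ, W (v γ) p) * propagator θ μ₀ ε p.2 p.1 ∂(gauss θ).prod (gauss θ)) := by
  simp only [← tsum_mul_right]
  refine hasSum_integral_of_summable_integral_norm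
    (fun γ => h.integrable_propagator hθ hε hμ₀ (v γ)) ?_
  refine Summable.of_nonneg_of_le (fun γ => integral_nonneg fun p => norm_nonneg _)
    (fun γ => ?_) (hv.mul_right (∫ p, C * (∫ β in Set.Ioi ε, Real.exp (-(μ₀ ^ 2 / 2) * β)) *
      loopWeight θ ε p ∂(gauss θ).prod (gauss θ)))
  rw [← integral_const_mul]
  exact integral_mono_of_nonneg (Eventually.of_forall fun p => norm_nonneg _)
    (((integrable_loopWeight hθ hε).const_mul _).const_mul _)
    (Eventually.of_forall fun p => h.norm_mul_propagator_le hθ hμ₀ (v γ) p)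

end GaussianVertex

end

/-! ### The two graphs of a single vertex mode -/

lemma nsq_le_two_mul (v a : Phase) : nsq v ≤ 2 * nsq (a + v) + 2 * nsq a := by
  simp only [nsq_eq_re_im, Fin.sum_univ_two, Pi.add_apply, add_re, add_im]
  nlinarith [sq_nonneg ((v 0).re + 2 * (a 0).re), sq_nonneg ((v 0).im + 2 * (a 0).im),
    sq_nonneg ((v 1).re + 2 * (a 1).re), sq_nonneg ((v 1).im + 2 * (a 1).im)]

lemma nsq_sub_le (a b : Phase) : nsq (a - b) ≤ 2 * nsq a + 2 * nsq b := by
  simp only [nsq_eq_re_im, Fin.sum_univ_two, Pi.sub_apply, sub_re, sub_im]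
  nlinarith [sq_nonneg ((a 0).re + (b 0).re), sq_nonneg ((a 0).im + (b 0).im),
    sq_nonneg ((a 1).re + (b 1).re), sq_nonneg ((a 1).im + (b 1).im)]

/-- Half of the Gaussian decay in `z - w + v` is traded for decay in `v`. -/
lemma norm_translationKernel_le_decay {θ t : ℝ} (hθ : 0 < θ) (ht : 0 ≤ t) (ht1 : t ≤ 1)
    (v z w : Phase) :
    ‖translationKernel θ v z w‖ ≤ Real.exp (-(freq θ * t / 4) * nsq v) *
      (Real.exp (freq θ * (1 / 2 + t) * nsq z) * Real.exp (freq θ * (1 / 2 + t) * nsq w)) := by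
  have hω := freq_pos hθ
  rw [norm_translationKernel, ← Real.exp_add, ← Real.exp_add, Real.exp_le_exp]
  have h1 := nsq_le_two_mul v (z - w)
  have h2 := nsq_sub_le z w
  have h3 := nsq_nonneg (z - w + v)
  have : (nsq z + nsq w - nsq (z - w + v)) / 2 ≤
      -(t / 4) * nsq v + (1 / 2 + t) * nsq z + (1 / 2 + t) * nsq w := by
    nlinarith [mul_nonneg (sub_nonneg.2 ht1) h3, mul_le_mul_of_nonneg_left h1 ht,
      mul_le_mul_of_nonneg_left h2 ht]
  nlinarith [mul_le_mul_of_nonneg_left this hω.le]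

lemma norm_translationKernel_le' {θ t : ℝ} (hθ : 0 < θ) (ht : 0 ≤ t) (v z w : Phase) :
    ‖translationKernel θ v z w‖ ≤
      Real.exp (freq θ * (1 / 2 + t) * nsq z) * Real.exp (freq θ * (1 / 2 + t) * nsq w) := by
  have hω := freq_pos hθ
  refine (norm_translationKernel_le hθ v z w).trans ?_
  have : ∀ z : Phase, freq θ / 2 * nsq z ≤ freq θ * (1 / 2 + t) * nsq z := fun z => by
    nlinarith [mul_nonneg (mul_nonneg hω.le ht) (nsq_nonneg z)]
  gcongr ?_ * ?_
  · exact Real.exp_le_exp.2 (this z)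
  · exact Real.exp_le_exp.2 (this w)

lemma continuous_translationKernel {X : Type*} [TopologicalSpace X] (θ : ℝ)
    {v z w : X → Phase} (hv : Continuous v) (hz : Continuous z) (hw : Continuous w) :
    Continuous (fun x => translationKernel θ (v x) (z x) (w x)) := by
  unfold translationKernel idKernel cdot nsq
  simp only [Pi.add_apply]
  fun_prop

/-- The constant in the Gaussian bounds for vertices with external arguments `z₁` and `z₂`. -/
noncomputable def vertexConst (θ lam t : ℝ) (z₁ z₂ : Phase) : ℝ :=
  |lam| / 2 * (Real.exp (freq θ * (1 / 2 + t) * nsq z₁) * Real.exp (freq θ * (1 / 2 + t) * nsq z₂))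

lemma gaussianVertex_loop {θ t : ℝ} (hθ : 0 < θ) (ht : 0 ≤ t) (ht1 : t ≤ 1) (lam : ℝ)
    (z₁ z₂ : Phase) :
    GaussianVertex θ t (vertexConst θ lam t z₁ z₂)
      fun v p => vertexMode θ lam v z₁ z₂ p.1 p.2 where
  cont := continuous_const.mul ((continuous_translationKernel θ (by fun_prop) (by fun_prop)
    (by fun_prop)).mul (continuous_translationKernel θ (by fun_prop) (by fun_prop)
    (by fun_prop)))
  bound v p := by
    rw [vertexMode, norm_mul, norm_mul]
    refine (mul_le_mul_of_nonneg_left (mul_le_mul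
      (norm_translationKernel_le_decay hθ ht ht1 v z₁ z₂)
      (norm_translationKernel_le' hθ ht (-v) p.1 p.2) (norm_nonneg _) (by positivity))
      (norm_nonneg _)).trans_eq ?_
    have : ‖(lam / 2 : ℂ)‖ = |lam| / 2 := by simp
    rw [this, vertexConst]
    ring

lemma gaussianVertex_line {θ t : ℝ} (hθ : 0 < θ) (ht : 0 ≤ t) (ht1 : t ≤ 1) (lam : ℝ)
    (z₁ z₂ : Phase) :
    GaussianVertex θ t (vertexConst θ lam t z₁ z₂)
      fun v p => vertexMode θ lam v z₁ p.2 p.1 z₂ where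
  cont := continuous_const.mul ((continuous_translationKernel θ (by fun_prop) (by fun_prop)
    (by fun_prop)).mul (continuous_translationKernel θ (by fun_prop) (by fun_prop)
    (by fun_prop)))
  bound v p := by
    rw [vertexMode, norm_mul, norm_mul]
    refine (mul_le_mul_of_nonneg_left (mul_le_mul
      (norm_translationKernel_le_decay hθ ht ht1 v z₁ p.2)
      (norm_translationKernel_le' hθ ht (-v) p.1 z₂) (norm_nonneg _) (by positivity))
      (norm_nonneg _)).trans_eq ?_
    have : ‖(lam / 2 : ℂ)‖ = |lam| / 2 := by simp
    rw [this, vertexConst]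
    ring

/-- The reproducing property of the coherent states, in the form needed to compose kernels. -/
lemma integral_gauss_cexp_reproducing {θ : ℝ} (hθ : 0 < θ) (b c : Phase) :
    ∫ z, cexp (freq θ * (∑ i, b i * z i + ∑ i, c i * conj (z i))) ∂gauss θ
      = cexp (freq θ * ∑ i, b i * c i) := by
  have := integral_gauss_cexp (A := 1) (s := 0) hθ (by norm_num) (by norm_num) b c
  simpa using this

lemma integral_gauss_cexp_trace {θ A : ℝ} (hθ : 0 < θ) (hA : 0 < A) (b c : Phase) :
    ∫ z, cexp (freq θ * ((1 - A) * nsq z + ∑ i, b i * z i + ∑ i, c i * conj (z i))) ∂gauss θ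
      = 1 / A ^ 2 * cexp (freq θ * ((∑ i, b i * c i) / A)) := by
  have := integral_gauss_cexp (A := A) (s := 0) hθ (by simpa) (by simpa) b c
  simpa using this

/-- The trace of the operator with parameter `v` times the heat operator: the integrand of the
coefficient of a mode, as a function of `s = |v|²`. -/
noncomputable def modeIntegrand (θ μ₀ s β : ℝ) : ℝ :=
  Real.exp (-(μ₀ ^ 2 / 2) * β) * (1 / (1 - Real.exp (-β * freq θ)) ^ 2 *
    Real.exp (-(freq θ / 2 * s * ((1 + Real.exp (-β * freq θ)) / (1 - Real.exp (-β * freq θ))))))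

/-- The coefficient with which the kernel of the translation by `v`, `|v|² = s`, occurs in the
regularized graphs. -/
noncomputable def modeCoeff (θ μ₀ s ε : ℝ) : ℝ := 1 / 2 * ∫ β in Set.Ioi ε, modeIntegrand θ μ₀ s β

/-- The kernel of `T_v exp(-β ω N) T_{-v}`, with `q = exp(-β ω)`. -/
noncomputable def conjugatedHeat (θ q : ℝ) (v z w : Phase) : ℂ :=
  cexp (freq θ * (cdot w z - (1 - q) * cdot (w + v) (z + v)))

lemma integral_loop_heatKernel {θ β : ℝ} (hθ : 0 < θ) (hβ : 0 < β) (lam μ₀ : ℝ)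
    (v z₁ z₂ : Phase) :
    ∫ p, vertexMode θ lam v z₁ z₂ p.1 p.2 * heatKernel θ μ₀ β p.2 p.1
        ∂(gauss θ).prod (gauss θ) =
      lam / 2 * translationKernel θ v z₁ z₂ * modeIntegrand θ μ₀ (nsq v) β := by
  have hq := exp_cutoff_lt_one hθ hβ
  have hG := gaussianVertex_loop hθ (decayRate_pos hθ hβ).le decayRate_le_one lam z₁ z₂
  rw [integral_prod _ (hG.integrable_heatKernel hθ hβ μ₀ le_rfl v)]
  simp only [modeIntegrand, show Real.exp (-(μ₀ ^ 2 / 2) * β) = Real.exp (-β * μ₀ ^ 2 / 2) by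
    congr 1; ring]
  set q := Real.exp (-β * freq θ) with hq_def
  -- The integral over `z₄` composes the two kernels, the one over `z₃` takes the trace.
  have inner : ∀ z₃ : Phase,
      (∫ z₄, vertexMode θ lam v z₁ z₂ z₃ z₄ * heatKernel θ μ₀ β z₄ z₃ ∂gauss θ) =
      (lam / 2 * translationKernel θ v z₁ z₂ * (Real.exp (-β * μ₀ ^ 2 / 2) : ℂ) *
        cexp (freq θ * (-nsq v / 2))) * cexp (freq θ * ((1 - (1 - q : ℝ)) * nsq z₃ +
          ∑ i, conj (v i) * z₃ i + ∑ i, (-(q * v i)) * conj (z₃ i))) := by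
    intro z₃
    have e := integral_gauss_cexp_reproducing hθ (fun i => q * conj (z₃ i))
      (fun i => z₃ i - v i)
    rw [mul_assoc _ (cexp _), ← Complex.exp_add]
    rw [show cexp (freq θ * (-nsq v / 2) + freq θ * ((1 - (1 - q : ℝ)) * nsq z₃ +
          ∑ i, conj (v i) * z₃ i + ∑ i, (-(q * v i)) * conj (z₃ i))) =
          cexp (freq θ * (-nsq v / 2 + ∑ i, conj (v i) * z₃ i)) *
            cexp (freq θ * ∑ i, q * conj (z₃ i) * (z₃ i - v i)) by
      rw [← Complex.exp_add, ofReal_nsq z₃]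
      congr 1
      simp only [Fin.sum_univ_two]
      push_cast
      ring, ← e, ← mul_assoc, ← integral_const_mul]
    refine integral_congr_ae (Eventually.of_forall fun z₄ => ?_)
    simp only [vertexMode, heatKernel, idKernel_smul, ← hq_def]
    rw [translationKernel.eq_def θ (-v) z₃ z₄, idKernel, ← Complex.exp_add]
    rw [show ∀ a b c d e : ℂ, a * (b * c) * (d * e) = a * b * d * (c * e) by intros; ring,
      mul_assoc _ (cexp _) (cexp _),
      ← Complex.exp_add, ← Complex.exp_add]
    congr 2
    have hn : nsq (-v) = nsq v := by simp [nsq]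
    rw [hn]
    simp only [cdot, Fin.sum_univ_two, Pi.neg_apply, Pi.add_apply, map_neg]
    ring
  simp only [inner]
  rw [integral_const_mul, integral_gauss_cexp_trace hθ (by linarith)]
  have h1 : (1 - q : ℂ) ≠ 0 := by exact_mod_cast (by linarith : (1 - q : ℝ) ≠ 0)
  push_cast
  rw [show ∀ a b c d e f : ℂ, a * b * c * d * (e * f) = a * b * (c * (e * (d * f))) by
    intros; ring, ← Complex.exp_add]
  congr 4
  rw [ofReal_nsq]
  simp only [Fin.sum_univ_two]
  field_simp
  ring

lemma integral_line_heatKernel {θ β : ℝ} (hθ : 0 < θ) (hβ : 0 < β) (lam μ₀ : ℝ)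
    (v z₁ z₂ : Phase) :
    ∫ p, vertexMode θ lam v z₁ p.2 p.1 z₂ * heatKernel θ μ₀ β p.2 p.1
        ∂(gauss θ).prod (gauss θ) =
      lam / 2 * ((Real.exp (-(μ₀ ^ 2 / 2) * β) : ℂ) *
        conjugatedHeat θ (Real.exp (-β * freq θ)) v z₁ z₂) := by
  have hG := gaussianVertex_line hθ (decayRate_pos hθ hβ).le decayRate_le_one lam z₁ z₂
  rw [integral_prod _ (hG.integrable_heatKernel hθ hβ μ₀ le_rfl v)]
  simp only [show Real.exp (-(μ₀ ^ 2 / 2) * β) = Real.exp (-β * μ₀ ^ 2 / 2) by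
    congr 1; ring]
  set q := Real.exp (-β * freq θ) with hq_def
  have inner : ∀ z₃ : Phase,
      (∫ z₄, vertexMode θ lam v z₁ z₄ z₃ z₂ * heatKernel θ μ₀ β z₄ z₃ ∂gauss θ) =
      (lam / 2 * (Real.exp (-β * μ₀ ^ 2 / 2) : ℂ) *
        cexp (freq θ * (-nsq v - cdot v z₁ - cdot z₂ v))) *
        cexp (freq θ * (∑ i, (conj (v i) + conj (z₂ i)) * z₃ i +
          ∑ i, (q * (z₁ i + v i)) * conj (z₃ i))) := by
    intro z₃
    have e := integral_gauss_cexp_reproducing hθ (fun i => q * conj (z₃ i))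
      (fun i => z₁ i + v i)
    rw [mul_assoc _ (cexp _), ← Complex.exp_add]
    rw [show cexp (freq θ * (-nsq v - cdot v z₁ - cdot z₂ v) +
        freq θ * (∑ i, (conj (v i) + conj (z₂ i)) * z₃ i +
          ∑ i, (q * (z₁ i + v i)) * conj (z₃ i))) =
        cexp (freq θ * (-nsq v - cdot v z₁ - cdot z₂ v +
          ∑ i, (conj (v i) + conj (z₂ i)) * z₃ i)) *
          cexp (freq θ * ∑ i, q * conj (z₃ i) * (z₁ i + v i)) by
      rw [← Complex.exp_add]
      congr 1
      simp only [Fin.sum_univ_two]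
      ring, ← e, ← mul_assoc, ← integral_const_mul]
    refine integral_congr_ae (Eventually.of_forall fun z₄ => ?_)
    simp only [vertexMode, heatKernel, idKernel_smul, ← hq_def]
    rw [translationKernel, translationKernel, idKernel, idKernel, ← Complex.exp_add,
      ← Complex.exp_add, ← Complex.exp_add]
    rw [show ∀ a b c d : ℂ, a * b * (c * d) = a * c * (b * d) by intros; ring,
      mul_assoc _ (cexp _) (cexp _),
      ← Complex.exp_add, ← Complex.exp_add]
    congr 2
    have hn : nsq (-v) = nsq v := by simp [nsq]
    rw [hn]
    simp only [cdot, Fin.sum_univ_two, Pi.neg_apply, Pi.add_apply, map_neg]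
    ring
  simp only [inner]
  rw [integral_const_mul, integral_gauss_cexp_reproducing hθ, mul_assoc, mul_assoc,
    ← Complex.exp_add, conjugatedHeat]
  congr 3
  rw [ofReal_nsq]
  simp only [cdot, Fin.sum_univ_two, Pi.add_apply, map_add]
  ring

/-- The closed loop factorizes from the external legs, as a trace. -/
lemma loopGraph_vertexMode {θ μ₀ ε : ℝ} (hθ : 0 < θ) (hμ₀ : μ₀ ≠ 0) (hε : 0 < ε) (lam : ℝ)
    (v z₁ z₂ : Phase) :
    loopGraph θ μ₀ ε (vertexMode θ lam v) z₁ z₂ =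
      (lam * modeCoeff θ μ₀ (nsq v) ε : ℝ) * translationKernel θ v z₁ z₂ := by
  have hG := gaussianVertex_loop hθ (decayRate_pos hθ hε).le decayRate_le_one lam z₁ z₂
  rw [loopGraph]
  simp only [loopIntegrand]
  rw [hG.integral_propagator hθ hε hμ₀ v, setIntegral_congr_fun measurableSet_Ioi
    (fun β hβ => integral_loop_heatKernel hθ (hε.trans hβ) lam μ₀ v z₁ z₂),
    integral_const_mul, integral_complex_ofReal, modeCoeff]
  push_cast
  ring

/-- The graph without a closed loop is the composition `T_v H_ε⁻¹ T_{-v}`. -/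
lemma lineGraph_vertexMode {θ μ₀ ε : ℝ} (hθ : 0 < θ) (hμ₀ : μ₀ ≠ 0) (hε : 0 < ε) (lam : ℝ)
    (v z₁ z₂ : Phase) :
    lineGraph θ μ₀ ε (vertexMode θ lam v) z₁ z₂ =
      lam * (1 / 2 * ∫ β in Set.Ioi ε, (Real.exp (-(μ₀ ^ 2 / 2) * β) : ℂ) *
        conjugatedHeat θ (Real.exp (-β * freq θ)) v z₁ z₂) := by
  have hG := gaussianVertex_line hθ (decayRate_pos hθ hε).le decayRate_le_one lam z₁ z₂
  rw [lineGraph]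
  simp only [lineIntegrand]
  rw [hG.integral_propagator hθ hε hμ₀ v, setIntegral_congr_fun measurableSet_Ioi
    (fun β hβ => integral_line_heatKernel hθ (hε.trans hβ) lam μ₀ v z₁ z₂),
    integral_const_mul]
  ring

/-! ### The coefficients of the modes as functions of the cut-off -/

lemma tendsto_setIntegral_Ioi_nhdsGT {f : ℝ → ℝ} (hf : IntegrableOn f (Set.Ioi 0)) :
    Tendsto (fun ε => ∫ β in Set.Ioi ε, f β) (𝓝[>] 0) (𝓝 (∫ β in Set.Ioi 0, f β)) := by
  have h : Tendsto (fun ε : ℝ => ∫ β in Set.Ioi 0, (Set.Ioi ε).indicator f β) (𝓝[>] 0)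
      (𝓝 (∫ β in Set.Ioi 0, f β)) := by
    refine tendsto_integral_filter_of_dominated_convergence (fun β => ‖f β‖) ?_ ?_ hf.norm ?_
    · exact Eventually.of_forall fun ε => hf.aestronglyMeasurable.indicator measurableSet_Ioi
    · exact Eventually.of_forall fun ε => Eventually.of_forall fun β =>
        norm_indicator_le_norm_self _ _
    · refine (ae_restrict_iff' measurableSet_Ioi).2 (Eventually.of_forall fun β hβ => ?_)
      refine tendsto_const_nhds.congr' ?_
      filter_upwards [Ioo_mem_nhdsGT (show (0 : ℝ) < β from hβ)] with ε hε
      rw [Set.indicator_of_mem (show β ∈ Set.Ioi ε from hε.2)]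
  refine h.congr' ?_
  filter_upwards [self_mem_nhdsWithin] with ε hε
  rw [setIntegral_indicator measurableSet_Ioi,
    Set.inter_eq_self_of_subset_right (Set.Ioi_subset_Ioi (le_of_lt hε))]

section
variable {θ : ℝ} (μ₀ : ℝ)

@[fun_prop]
lemma measurable_modeIntegrand (θ μ₀ s : ℝ) : Measurable (modeIntegrand θ μ₀ s) := by
  unfold modeIntegrand
  fun_prop

lemma modeIntegrand_nonneg (θ μ₀ s β : ℝ) : 0 ≤ modeIntegrand θ μ₀ s β := by
  unfold modeIntegrand
  positivity

lemma modeIntegrand_le_of_le {ε β s : ℝ} (hθ : 0 < θ) (hε : 0 < ε) (hβ : ε ≤ β) (hs : 0 ≤ s) :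
    modeIntegrand θ μ₀ s β ≤ Real.exp (-(μ₀ ^ 2 / 2) * β) *
      (1 / (1 - Real.exp (-ε * freq θ)) ^ 2 * Real.exp (-(freq θ / 4 * s))) := by
  have hω := freq_pos hθ
  have h1 := exp_cutoff_lt_one hθ hε
  have h2 : Real.exp (-β * freq θ) ≤ Real.exp (-ε * freq θ) := by
    rw [Real.exp_le_exp]; nlinarith
  unfold modeIntegrand
  set q := Real.exp (-β * freq θ)
  have hq : 0 < q := Real.exp_pos _
  have h3 : 1 ≤ (1 + q) / (1 - q) := by
    rw [le_div_iff₀ (by linarith)]; linarith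
  have h4 : freq θ / 4 * s ≤ freq θ / 2 * s := by nlinarith [mul_nonneg hω.le hs]
  refine mul_le_mul_of_nonneg_left (mul_le_mul ?_ ?_ (Real.exp_pos _).le (by positivity))
    (Real.exp_pos _).le
  · exact one_div_le_one_div_of_le (by have := sub_pos.2 h1; positivity)
      (pow_le_pow_left₀ (by linarith) (by linarith) 2)
  · exact Real.exp_le_exp.2
      (neg_le_neg (h4.trans (le_mul_of_one_le_right (by positivity) h3)))

/-- Away from `s = 0` the singularity of the integrand at `β = 0` is suppressed. -/
lemma modeIntegrand_le {β s s₀ : ℝ} (hθ : 0 < θ) (hβ : 0 < β) (hs₀ : 0 < s₀) (hs : s₀ ≤ s) :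
    modeIntegrand θ μ₀ s β ≤ Real.exp (-(μ₀ ^ 2 / 2) * β) *
      (2 / (freq θ / 4 * s₀) ^ 2 * Real.exp (-(freq θ / 4 * s))) := by
  have hω := freq_pos hθ
  have h1 := exp_cutoff_lt_one hθ hβ
  unfold modeIntegrand
  set q := Real.exp (-β * freq θ)
  have hq : 0 < q := Real.exp_pos _
  set y := (1 + q) / (1 - q) with hy
  have h3 : 1 ≤ y := by
    rw [hy, le_div_iff₀ (by linarith)]; linarith
  have h4 : 1 / (1 - q) ^ 2 ≤ y ^ 2 := by
    rw [hy, div_pow]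
    have : 0 < 1 - q := by linarith
    gcongr
    nlinarith
  have h5 : y ^ 2 * Real.exp (-(freq θ / 4 * s₀ * y)) ≤ 2 / (freq θ / 4 * s₀) ^ 2 := by
    have hx : 0 ≤ freq θ / 4 * s₀ * y := by positivity
    have := Real.quadratic_le_exp_of_nonneg hx
    rw [Real.exp_neg, ← div_eq_mul_inv, div_le_div_iff₀ (Real.exp_pos _) (by positivity)]
    nlinarith
  have h6 : Real.exp (-(freq θ / 2 * s * y)) ≤
      Real.exp (-(freq θ / 4 * s₀ * y)) * Real.exp (-(freq θ / 4 * s)) := by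
    rw [← Real.exp_add, Real.exp_le_exp]
    have e1 : freq θ / 4 * s₀ * y ≤ freq θ / 4 * s * y := by gcongr
    have e2 : freq θ / 4 * s ≤ freq θ / 4 * s * y :=
      le_mul_of_one_le_right (by have := hs₀.le.trans hs; positivity) h3
    linarith
  refine mul_le_mul_of_nonneg_left ?_ (Real.exp_pos _).le
  calc 1 / (1 - q) ^ 2 * Real.exp (-(freq θ / 2 * s * y))
      ≤ y ^ 2 * (Real.exp (-(freq θ / 4 * s₀ * y)) * Real.exp (-(freq θ / 4 * s))) := by gcongr
    _ = (y ^ 2 * Real.exp (-(freq θ / 4 * s₀ * y))) * Real.exp (-(freq θ / 4 * s)) := by ring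
    _ ≤ _ := by gcongr

variable {μ₀}

lemma integrableOn_modeIntegrand {ε s : ℝ} (hθ : 0 < θ) (hμ₀ : μ₀ ≠ 0) (hε : 0 < ε)
    (hs : 0 ≤ s) : IntegrableOn (modeIntegrand θ μ₀ s) (Set.Ioi ε) := by
  refine Integrable.mono' ((integrableOn_exp_mass hμ₀ ε).mul_const _)
    (measurable_modeIntegrand θ μ₀ s).aestronglyMeasurable
    ((ae_restrict_iff' measurableSet_Ioi).2 (Eventually.of_forall fun β hβ =>
      (Real.norm_of_nonneg (modeIntegrand_nonneg _ _ _ _)).trans_le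
        (modeIntegrand_le_of_le μ₀ hθ hε (le_of_lt hβ) hs)))

lemma integrableOn_modeIntegrand_zero {s : ℝ} (hθ : 0 < θ) (hμ₀ : μ₀ ≠ 0)
    (hs : 0 < s) : IntegrableOn (modeIntegrand θ μ₀ s) (Set.Ioi 0) := by
  refine Integrable.mono' ((integrableOn_exp_mass hμ₀ 0).mul_const _)
    (measurable_modeIntegrand θ μ₀ s).aestronglyMeasurable
    ((ae_restrict_iff' measurableSet_Ioi).2 (Eventually.of_forall fun β hβ =>
      (Real.norm_of_nonneg (modeIntegrand_nonneg _ _ _ _)).trans_le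
        (modeIntegrand_le μ₀ hθ hβ hs le_rfl)))

lemma modeCoeff_nonneg (θ μ₀ s ε : ℝ) : 0 ≤ modeCoeff θ μ₀ s ε :=
  mul_nonneg (by norm_num) (integral_nonneg fun β => modeIntegrand_nonneg θ μ₀ s β)

lemma integral_modeIntegrand_le_of_pos {ε s : ℝ} (hθ : 0 < θ) (hμ₀ : μ₀ ≠ 0) (hε : 0 < ε)
    (hs : 0 ≤ s) : ∫ β in Set.Ioi ε, modeIntegrand θ μ₀ s β ≤
      ((∫ β in Set.Ioi ε, Real.exp (-(μ₀ ^ 2 / 2) * β)) *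
        (1 / (1 - Real.exp (-ε * freq θ)) ^ 2)) * Real.exp (-(freq θ / 4 * s)) := by
  rw [mul_assoc, ← integral_mul_const]
  exact setIntegral_mono_on (integrableOn_modeIntegrand hθ hμ₀ hε hs)
    ((integrableOn_exp_mass hμ₀ ε).mul_const _) measurableSet_Ioi
    fun β hβ => modeIntegrand_le_of_le μ₀ hθ hε (le_of_lt hβ) hs

lemma modeCoeff_le_of_pos {ε : ℝ} (hθ : 0 < θ) (hμ₀ : μ₀ ≠ 0) (hε : 0 < ε) :
    ∃ K, ∀ s, 0 ≤ s → modeCoeff θ μ₀ s ε ≤ K * Real.exp (-(freq θ / 4 * s)) := by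
  refine ⟨1 / 2 * ((∫ β in Set.Ioi ε, Real.exp (-(μ₀ ^ 2 / 2) * β)) *
        (1 / (1 - Real.exp (-ε * freq θ)) ^ 2)), fun s hs => ?_⟩
  rw [modeCoeff, mul_assoc]
  exact mul_le_mul_of_nonneg_left (integral_modeIntegrand_le_of_pos hθ hμ₀ hε hs) (by norm_num)

/-- Uniformly in the cut-off, the coefficients of the nonzero modes are Gaussian in the mode. -/
lemma modeCoeff_le {s₀ : ℝ} (hθ : 0 < θ) (hμ₀ : μ₀ ≠ 0) (hs₀ : 0 < s₀) :
    ∃ K, ∀ s, s₀ ≤ s → ∀ ε, 0 ≤ ε → modeCoeff θ μ₀ s ε ≤ K * Real.exp (-(freq θ / 4 * s)) := by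
  refine ⟨1 / 2 * ((∫ β in Set.Ioi 0, Real.exp (-(μ₀ ^ 2 / 2) * β)) *
        (2 / (freq θ / 4 * s₀) ^ 2)), fun s hs ε hε => ?_⟩
  have hint := integrableOn_modeIntegrand_zero hθ hμ₀ (hs₀.trans_le hs)
  rw [modeCoeff, mul_assoc]
  refine mul_le_mul_of_nonneg_left ?_ (by norm_num)
  refine (setIntegral_mono_set hint
    (Eventually.of_forall fun β => modeIntegrand_nonneg θ μ₀ s β)
    (Set.Ioi_subset_Ioi hε).eventuallyLE).trans ?_
  rw [mul_assoc, ← integral_mul_const]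
  exact setIntegral_mono_on hint ((integrableOn_exp_mass hμ₀ 0).mul_const _) measurableSet_Ioi
    fun β hβ => modeIntegrand_le μ₀ hθ hβ hs₀ hs

lemma tendsto_modeCoeff {s : ℝ} (hθ : 0 < θ) (hμ₀ : μ₀ ≠ 0) (hs : 0 < s) :
    Tendsto (modeCoeff θ μ₀ s) (𝓝[>] 0) (𝓝 (modeCoeff θ μ₀ s 0)) :=
  (tendsto_setIntegral_Ioi_nhdsGT (integrableOn_modeIntegrand_zero hθ hμ₀ hs)).const_mul _

/-! ### The divergence of the zero mode -/

/-- The Taylor remainder of `exp (a β)`, divided by its order `β ^ n`, is bounded near `0⁺`. -/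
lemma exists_taylor_remainder_bound (a : ℝ) (n : ℕ) : ∃ c δ : ℝ, 0 ≤ c ∧ 0 < δ ∧
    ∀ β, 0 < β → β < δ →
      |(Real.exp (a * β) - ∑ i ∈ Finset.range n, (a * β) ^ i / i.factorial) / β ^ n| ≤ c := by
  have h := (Real.exp_sub_sum_range_isBigO_pow n).comp_tendsto
    (k := fun β : ℝ => a * β) (l' := 𝓝 0) (by
      have : Continuous fun β : ℝ => a * β := by fun_prop
      simpa using this.tendsto 0)
  obtain ⟨c, hc, hb⟩ := h.exists_nonneg
  obtain ⟨δ, hδ, hball⟩ := Metric.eventually_nhds_iff.1 hb.bound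
  refine ⟨c * |a| ^ n, δ, by positivity, hδ, fun β hβ hβδ => ?_⟩
  have := hball (y := β) (by rw [Real.dist_eq, sub_zero, abs_of_pos hβ]; exact hβδ)
  simp only [Function.comp_apply, Real.norm_eq_abs, abs_pow, abs_mul] at this
  rw [abs_div, div_le_iff₀ (by positivity), abs_pow, mul_assoc, ← mul_pow]
  exact this

/-- The singular part of the integrand of the zero mode at `β = 0`. -/
noncomputable def singularIntegrand (ω m β : ℝ) : ℝ := 1 / (β * ω) ^ 2 + (1 - m / ω) / (β * ω)

/-- The integrand of the zero mode differs from its singular part by a bounded function. -/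
lemma exists_bound_sub_singularIntegrand {ω : ℝ} (hω : 0 < ω) (m : ℝ) :
    ∃ c η : ℝ, 0 < η ∧ ∀ β, 0 < β → β ≤ η →
      |Real.exp (-m * β) * (1 / (1 - Real.exp (-ω * β)) ^ 2) - singularIntegrand ω m β| ≤ c := by
  obtain ⟨c₁, δ₁, hc₁, hδ₁, h₁⟩ := exists_taylor_remainder_bound (-m) 2
  obtain ⟨c₂, δ₂, hc₂, hδ₂, h₂⟩ := exists_taylor_remainder_bound (-ω) 3
  -- With `exp(-mβ) = 1 - mβ + β²σ` and `exp(-ωβ) = 1 - ωβ + ω²β²/2 + β³ρ` the difference is a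
  -- continuous function of `(β, σ, ρ)`, which ranges in a compact set.
  let e : ℝ × ℝ × ℝ → ℝ := fun x => ω - ω ^ 2 * x.1 / 2 - x.1 ^ 2 * x.2.2
  let F : ℝ × ℝ × ℝ → ℝ := fun x =>
    (ω ^ 2 * x.2.1 - ω ^ 2 * (ω ^ 2 / 4 - ω * (ω - m) + x.1 * ((ω - m) * ω ^ 2 / 4))
      - (1 + x.1 * (ω - m)) * (-2 * (ω - x.1 * ω ^ 2 / 2) * x.2.2 + x.1 ^ 2 * x.2.2 ^ 2)) /
      (ω ^ 2 * e x ^ 2)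
  let η := min (min (δ₁ / 2) (δ₂ / 2)) (min 1 (ω / (ω ^ 2 + 2 * c₂)))
  have hη : 0 < η := by positivity
  have hη1 : η ≤ 1 := (min_le_right _ _).trans (min_le_left _ _)
  have hη2 : η * (ω ^ 2 + 2 * c₂) ≤ ω := by
    rw [← le_div_iff₀ (by positivity)]
    exact (min_le_right _ _).trans (min_le_right _ _)
  let S := Set.Icc (0 : ℝ) η ×ˢ (Set.Icc (-c₁) c₁ ×ˢ Set.Icc (-c₂) c₂)
  have he : ∀ x ∈ S, ω / 2 ≤ e x := by
    rintro ⟨β, σ, ρ⟩ ⟨hβ, -, hρ⟩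
    simp only [Set.mem_Icc] at hβ hρ
    simp only [e]
    have h1 : β ^ 2 * ρ ≤ β * c₂ := by
      have : β * ρ ≤ c₂ := by nlinarith
      nlinarith
    nlinarith [mul_nonneg (sub_nonneg.2 hβ.2) (by positivity : 0 ≤ ω ^ 2 + 2 * c₂)]
  have hS : IsCompact S := isCompact_Icc.prod (isCompact_Icc.prod isCompact_Icc)
  have hF : ContinuousOn F S := by
    refine ContinuousOn.div (by fun_prop) (by fun_prop) fun x hx => ?_
    have := (half_pos hω).trans_le (he x hx)
    positivity
  obtain ⟨c, hc⟩ := hS.exists_bound_of_continuousOn hF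
  refine ⟨c, η, hη, fun β hβ hβη => ?_⟩
  have hβ1 : β < δ₁ := hβη.trans_lt
    (((min_le_left _ _).trans (min_le_left _ _)).trans_lt (by linarith))
  have hβ2 : β < δ₂ := hβη.trans_lt
    (((min_le_left _ _).trans (min_le_right _ _)).trans_lt (by linarith))
  have hσ := h₁ β hβ hβ1
  have hρ := h₂ β hβ hβ2
  set σ := (Real.exp (-m * β) - ∑ i ∈ Finset.range 2, (-m * β) ^ i / i.factorial) / β ^ 2 with hσ'
  set ρ := (Real.exp (-ω * β) - ∑ i ∈ Finset.range 3, (-ω * β) ^ i / i.factorial) / β ^ 3 with hρ'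
  have hmem : (β, σ, ρ) ∈ S := ⟨⟨hβ.le, hβη⟩, abs_le.1 hσ, abs_le.1 hρ⟩
  have hpos := (half_pos hω).trans_le (he _ hmem)
  have hb := hc _ hmem
  have e1 : Real.exp (-m * β) = 1 - m * β + β ^ 2 * σ := by
    rw [hσ']
    simp only [Finset.sum_range_succ, Finset.sum_range_zero, Nat.factorial]
    field_simp
    push_cast
    ring
  have e2 : 1 - Real.exp (-ω * β) = β * e (β, σ, ρ) := by
    simp only [e]
    rw [hρ']
    simp only [Finset.sum_range_succ, Finset.sum_range_zero, Nat.factorial]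
    field_simp
    push_cast
    ring
  convert! hb using 1
  rw [Real.norm_eq_abs]
  congr 1
  rw [e2, e1]
  simp only [F, singularIntegrand]
  have hne := hpos.ne'
  have hE : e (β, σ, ρ) = ω - ω ^ 2 * β / 2 - β ^ 2 * ρ := rfl
  generalize e (β, σ, ρ) = E at hne hE ⊢
  field_simp
  rw [hE]
  ring

lemma integral_singularIntegrand {ω ε η : ℝ} (hω : 0 < ω) (m : ℝ) (hε : 0 < ε) (hεη : ε ≤ η) :
    ∫ β in Set.Ioc ε η, singularIntegrand ω m β =
      (-1 / (ω ^ 2 * η) + (1 - m / ω) / ω * Real.log η) -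
        (-1 / (ω ^ 2 * ε) + (1 - m / ω) / ω * Real.log ε) := by
  rw [← intervalIntegral.integral_of_le hεη]
  have hne : ∀ β ∈ Set.uIcc ε η, β ≠ 0 := by
    intro β hβ
    rw [Set.uIcc_of_le hεη] at hβ
    exact (hε.trans_le hβ.1).ne'
  refine intervalIntegral.integral_eq_sub_of_hasDerivAt
    (f := fun β => -1 / (ω ^ 2 * β) + (1 - m / ω) / ω * Real.log β) (fun β hβ => ?_) ?_
  · have h0 := hne β hβ
    have h1 := ((hasDerivAt_id β).const_mul (ω ^ 2)).inv (by simp; exact ⟨hω.ne', h0⟩)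
    have h2 := (h1.const_mul (-1)).add ((Real.hasDerivAt_log h0).const_mul ((1 - m / ω) / ω))
    convert! h2 using 1
    simp only [singularIntegrand, id]
    field_simp
  · refine ContinuousOn.intervalIntegrable ?_
    unfold singularIntegrand
    refine ContinuousOn.add (ContinuousOn.div (by fun_prop) (by fun_prop) fun β hβ => ?_)
      (ContinuousOn.div (by fun_prop) (by fun_prop) fun β hβ => ?_)
    · have := hne β hβ; positivity
    · exact mul_ne_zero (hne β hβ) hω.ne'

/-- The integral of the singular part over `(ε, η]` produces the singular factor, up to a constant
that depends on `η`. -/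
lemma tendsto_modeCoeff_zero_sub (hθ : 0 < θ) (hμ₀ : μ₀ ≠ 0) :
    ∃ ℓ : ℝ, Tendsto (fun ε => modeCoeff θ μ₀ 0 ε - 1 / (2 * freq θ) * singularFactor θ μ₀ ε)
      (𝓝[>] 0) (𝓝 ℓ) := by
  have hω := freq_pos hθ
  obtain ⟨c, η, hη, hb⟩ := exists_bound_sub_singularIntegrand hω (μ₀ ^ 2 / 2)
  have hf : ∀ β, modeIntegrand θ μ₀ 0 β = Real.exp (-(μ₀ ^ 2 / 2) * β) *
      (1 / (1 - Real.exp (-freq θ * β)) ^ 2) := by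
    intro β
    simp [modeIntegrand, mul_comm β]
  let S := singularIntegrand (freq θ) (μ₀ ^ 2 / 2)
  have hSm : Measurable S := by
    simp only [S]
    unfold singularIntegrand
    fun_prop
  let g : ℝ → ℝ := fun β => modeIntegrand θ μ₀ 0 β - (Set.Iic η).indicator S β
  have hgm : Measurable g :=
    (measurable_modeIntegrand θ μ₀ 0).sub (hSm.indicator measurableSet_Iic)
  have hg : IntegrableOn g (Set.Ioi 0) := by
    rw [← Set.Ioc_union_Ioi_eq_Ioi hη.le]
    refine IntegrableOn.union ?_ ?_
    · refine Measure.integrableOn_of_bounded (M := c) (by simp) hgm.aestronglyMeasurable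
        ((ae_restrict_iff' measurableSet_Ioc).2 (Eventually.of_forall fun β hβ => ?_))
      simp only [g]
      rw [Set.indicator_of_mem (show β ∈ Set.Iic η from hβ.2), hf]
      exact hb β hβ.1 hβ.2
    · refine (integrableOn_modeIntegrand hθ hμ₀ hη le_rfl).congr_fun (fun β hβ => ?_)
        measurableSet_Ioi
      simp only [g]
      rw [Set.indicator_of_notMem (by simpa using hβ), sub_zero]
  have key := (tendsto_setIntegral_Ioi_nhdsGT hg).const_mul (1 / 2)
  refine ⟨_, (key.add_const (1 / 2 * (-1 / ((freq θ) ^ 2 * η) +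
    (1 - (μ₀ ^ 2 / 2) / freq θ) / freq θ * Real.log η))).congr' ?_⟩
  filter_upwards [Ioo_mem_nhdsGT hη] with ε hε
  have hfi := integrableOn_modeIntegrand (s := 0) hθ hμ₀ hε.1 le_rfl
  have hgi : IntegrableOn g (Set.Ioi ε) := hg.mono_set (Set.Ioi_subset_Ioi hε.1.le)
  have hsplit : ∫ β in Set.Ioi ε, g β = (∫ β in Set.Ioi ε, modeIntegrand θ μ₀ 0 β) -
      ∫ β in Set.Ioc ε η, S β := by
    have hS : IntegrableOn ((Set.Iic η).indicator S) (Set.Ioi ε) := by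
      refine (hfi.sub hgi).congr (Eventually.of_forall fun β => ?_)
      simp [g]
    simp only [g]
    rw [integral_sub hfi hS, setIntegral_indicator measurableSet_Iic, Set.Ioi_inter_Iic]
  rw [hsplit, integral_singularIntegrand hω _ hε.1 hε.2.le, modeCoeff, singularFactor,
    one_div ε, Real.log_inv]
  have := hε.1.ne'
  field_simp
  ring

end

/-! ### Sums over the lattice -/

/-- The squared Euclidean length of a label in `ℤ⁴`. -/
def labelSq (γ : Label) : ℝ := ∑ i, ((γ.1 i : ℝ) ^ 2 + (γ.2 i : ℝ) ^ 2)

/-- The point `i (k₁ + i k₂)/√2`: up to the unitary factor `i`, the dual lattice vector `γ*`. -/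
noncomputable def dualPoint (k : Label) : Phase :=
  fun i => I * ((k.1 i : ℂ) + I * (k.2 i : ℂ)) / (Real.sqrt 2 : ℂ)

lemma norm_sq_ofReal_add_I_mul (x y : ℝ) : ‖(x : ℂ) + I * y‖ ^ 2 = x ^ 2 + y ^ 2 := by
  rw [← Complex.normSq_eq_norm_sq, mul_comm, Complex.normSq_add_mul_I]

lemma nsq_phasePoint (θ : ℝ) (p : (Fin 2 → ℝ) × (Fin 2 → ℝ)) :
    nsq (phasePoint θ p) = θ ^ 2 / 2 * ∑ i, (p.1 i ^ 2 + p.2 i ^ 2) := by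
  simp only [nsq, phasePoint, norm_mul, mul_pow, norm_sq_ofReal_add_I_mul, ← Finset.mul_sum,
    norm_real, Real.norm_eq_abs, sq_abs, div_pow]
  norm_num

lemma nsq_latticePoint (θ : ℝ) (γ : Label) :
    nsq (latticePoint θ γ) = θ ^ 2 / 2 * labelSq γ :=
  nsq_phasePoint θ _

lemma nsq_dualPoint (k : Label) : nsq (dualPoint k) = 1 / 2 * labelSq k := by
  have := fun i => norm_sq_ofReal_add_I_mul (k.1 i : ℝ) (k.2 i)
  simp only [ofReal_intCast] at this
  simp only [nsq, dualPoint, norm_mul, norm_div, norm_I, one_mul, div_pow, this, labelSq,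
    ← Finset.sum_div, norm_real, Real.norm_eq_abs, sq_abs]
  norm_num
  ring

lemma one_le_labelSq {γ : Label} (hγ : γ ≠ 0) : 1 ≤ labelSq γ := by
  have hint : labelSq γ = ((∑ i, (γ.1 i ^ 2 + γ.2 i ^ 2) : ℤ) : ℝ) := by
    simp [labelSq]
  rw [hint]
  by_contra! h
  have h' : ∑ i, (γ.1 i ^ 2 + γ.2 i ^ 2) < 1 := by exact_mod_cast h
  rw [Fin.sum_univ_two] at h'
  apply hγ
  have hz : ∀ a : ℤ, a ^ 2 ≤ 0 → a = 0 := fun a ha => by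
    have := sq_nonneg a; exact pow_eq_zero_iff (n := 2) (by norm_num) |>.1 (by omega)
  have q1 := sq_nonneg (γ.1 0)
  have q2 := sq_nonneg (γ.1 1)
  have q3 := sq_nonneg (γ.2 0)
  have q4 := sq_nonneg (γ.2 1)
  have h1 : ∀ i, γ.1 i = 0 := Fin.forall_fin_two.2 ⟨hz _ (by linarith), hz _ (by linarith)⟩
  have h2 : ∀ i, γ.2 i = 0 := Fin.forall_fin_two.2 ⟨hz _ (by linarith), hz _ (by linarith)⟩
  exact Prod.ext (funext h1) (funext h2)

lemma hasSum_finTwo_prod {f : Fin 2 → ℤ → ℂ} (hf : ∀ i, Summable (f i)) :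
    HasSum (fun m : Fin 2 → ℤ => ∏ i, f i (m i)) (∏ i, ∑' n, f i n) := by
  rw [← (finTwoArrowEquiv ℤ).symm.hasSum_iff]
  simp only [Fin.prod_univ_two, Function.comp_def, finTwoArrowEquiv_symm_apply,
    Matrix.cons_val_zero, Matrix.cons_val_one]
  exact (hf 0).hasSum.mul (hf 1).hasSum (summable_mul_of_summable_norm (hf 0).norm (hf 1).norm)

lemma hasSum_label_mul {F G : (Fin 2 → ℤ) → ℂ} {a b : ℂ} (hF : HasSum F a) (hG : HasSum G b) :
    HasSum (fun γ : Label => F γ.1 * G γ.2) (a * b) :=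
  hF.mul hG (summable_mul_of_summable_norm hF.summable.norm hG.summable.norm)

/-- A sum over `ℤ² × ℤ²` of products of functions of the single coordinates factorizes. -/
lemma hasSum_label_prod {f g : Fin 2 → ℤ → ℂ} (hf : ∀ i, Summable (f i))
    (hg : ∀ i, Summable (g i)) :
    HasSum (fun γ : Label => (∏ i, f i (γ.1 i)) * ∏ i, g i (γ.2 i))
      ((∏ i, ∑' n, f i n) * ∏ i, ∑' n, g i n) :=
  hasSum_label_mul (F := fun m => ∏ i, f i (m i)) (G := fun m => ∏ i, g i (m i))
    (hasSum_finTwo_prod hf) (hasSum_finTwo_prod hg)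

lemma summable_cexp_quadratic {a : ℝ} (ha : 0 < a) (b : ℂ) :
    Summable fun n : ℤ => cexp (-Real.pi * a * n ^ 2 + 2 * Real.pi * b * n) := by
  have h := (summable_jacobiTheta₂_term_iff (-I * b) (I * a)).2 (by simpa using ha)
  refine h.congr fun n => ?_
  rw [jacobiTheta₂_term]
  congr 1
  have hI : I ^ 2 = -1 := I_sq
  ring_nf
  simp only [hI]
  ring

lemma summable_exp_labelSq {b : ℝ} (hb : 0 < b) :
    Summable fun γ : Label => Real.exp (-b * labelSq γ) := by
  have hs : ∀ _ : Fin 2, Summable fun n : ℤ =>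
      cexp (-Real.pi * (b / Real.pi : ℝ) * n ^ 2 + 2 * Real.pi * 0 * n) :=
    fun _ => summable_cexp_quadratic (by positivity) 0
  refine ((hasSum_label_prod hs hs).summable.norm).congr fun γ => ?_
  have hπ : (Real.pi : ℂ) ≠ 0 := by exact_mod_cast Real.pi_ne_zero
  rw [← Real.norm_of_nonneg (Real.exp_pos _).le, ← norm_real, ofReal_exp]
  congr 1
  simp only [Fin.prod_univ_two, ← Complex.exp_add, labelSq, Fin.sum_univ_two]
  congr 1
  push_cast
  field_simp
  ring

lemma summable_exp_nsq_latticePoint {θ b : ℝ} (hθ : 0 < θ) (hb : 0 < b) :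
    Summable fun γ : Label => Real.exp (-b * nsq (latticePoint θ γ)) := by
  refine (summable_exp_labelSq (b := b * (θ ^ 2 / 2)) (by positivity)).congr fun γ => ?_
  rw [nsq_latticePoint]
  congr 1
  ring

lemma summable_exp_nsq_dualPoint {b : ℝ} (hb : 0 < b) :
    Summable fun k : Label => Real.exp (-b * nsq (dualPoint k)) := by
  refine (summable_exp_labelSq (b := b * (1 / 2)) (by positivity)).congr fun γ => ?_
  rw [nsq_dualPoint]
  congr 1
  ring

/-! ### Poisson resummation of the conjugated heat kernels -/

/-- The Fourier coefficient at `k` of the conjugated heat kernels: again the kernel of a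
translation, by the dual lattice vector, with the same coefficient as in the closed loop. -/
noncomputable def dualHeat (θ q : ℝ) (k : Label) (z w : Phase) : ℂ :=
  ((1 / θ ^ 2 * (1 / (1 - q) ^ 2 *
    Real.exp (-(freq θ / 2 * nsq (dualPoint k) * ((1 + q) / (1 - q))))) : ℝ) : ℂ) *
    translationKernel θ (dualPoint k) z w

/-- The linear coefficients of the Gaussian in the real parts of the translation vector. -/
noncomputable def reShift (q : ℝ) (z w : Phase) (i : Fin 2) : ℂ :=
  -(1 - q) * (conj (w i) + z i) / (Real.sqrt 2 : ℂ)

/-- The linear coefficients of the Gaussian in the imaginary parts of the translation vector. -/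
noncomputable def imShift (q : ℝ) (z w : Phase) (i : Fin 2) : ℂ :=
  -I * (1 - q) * (conj (w i) - z i) / (Real.sqrt 2 : ℂ)

lemma ofReal_sqrt_two_sq : ((Real.sqrt 2 : ℝ) : ℂ) ^ 2 = 2 := by
  rw [← ofReal_pow, Real.sq_sqrt (by norm_num)]; norm_num

lemma ofReal_sqrt_two_ne_zero : ((Real.sqrt 2 : ℝ) : ℂ) ≠ 0 := by
  intro h
  have := ofReal_sqrt_two_sq
  rw [h] at this
  norm_num at this

lemma ofReal_freq (θ : ℝ) : (freq θ : ℂ) = 2 * Real.pi / θ := by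
  simp [freq]

lemma inv_ofReal_sqrt_two_sq : ((Real.sqrt 2 : ℝ) : ℂ)⁻¹ ^ 2 = 1 / 2 := by
  rw [inv_pow, ofReal_sqrt_two_sq, one_div]

lemma conjugatedHeat_exponent {θ : ℝ} (hθ : 0 < θ) (q x y : ℝ) (W Z : ℂ) :
    2 * Real.pi / θ * (W * Z - (1 - q) * ((W + ((θ / Real.sqrt 2 : ℝ) : ℂ) * (x + -I * y)) *
      (Z + ((θ / Real.sqrt 2 : ℝ) : ℂ) * (x + I * y)))) =
    2 * Real.pi / θ * (q * (W * Z)) +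
      (-Real.pi * (θ * (1 - q) : ℝ) * x ^ 2
        + 2 * Real.pi * (-(1 - q) * (W + Z) / (Real.sqrt 2 : ℂ)) * x) +
      (-Real.pi * (θ * (1 - q) : ℝ) * y ^ 2
        + 2 * Real.pi * (-I * (1 - q) * (W - Z) / (Real.sqrt 2 : ℂ)) * y) := by
  have hr := inv_ofReal_sqrt_two_sq
  have ht : (θ : ℂ)⁻¹ * θ = 1 := inv_mul_cancel₀ (by exact_mod_cast hθ.ne')
  push_cast
  simp only [div_eq_mul_inv]
  generalize ((Real.sqrt 2 : ℝ) : ℂ)⁻¹ = r at hr ⊢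
  generalize (θ : ℂ)⁻¹ = t at ht ⊢
  linear_combination (-2 * Real.pi * (1 - q) * r * (W * (x + I * y) + Z * (x - I * y))
      - 2 * Real.pi * (1 - q) * θ * r ^ 2 * (x ^ 2 - I ^ 2 * y ^ 2)) * ht
    - 2 * Real.pi * (1 - q) * θ * (x ^ 2 - I ^ 2 * y ^ 2) * hr
    + Real.pi * θ * (1 - q) * y ^ 2 * I_sq

/-- The Gaussian in the translation vector factorizes into its real coordinates. -/
lemma conjugatedHeat_phasePoint {θ : ℝ} (hθ : 0 < θ) (q : ℝ) (z w : Phase)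
    (p : (Fin 2 → ℝ) × (Fin 2 → ℝ)) :
    conjugatedHeat θ q (phasePoint θ p) z w = cexp (freq θ * (q * cdot w z)) *
      ((∏ i, cexp (-Real.pi * (θ * (1 - q) : ℝ) * p.1 i ^ 2
          + 2 * Real.pi * reShift q z w i * p.1 i)) *
        ∏ i, cexp (-Real.pi * (θ * (1 - q) : ℝ) * p.2 i ^ 2
          + 2 * Real.pi * imShift q z w i * p.2 i)) := by
  simp only [Fin.prod_univ_two, ← Complex.exp_add, conjugatedHeat, cdot, Fin.sum_univ_two,
    phasePoint, Pi.add_apply, map_add, map_mul, conj_ofReal, conj_I, reShift, imShift, ofReal_freq]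
  congr 1
  linear_combination conjugatedHeat_exponent hθ q (p.1 0) (p.2 0) (conj (w 0)) (z 0) +
    conjugatedHeat_exponent hθ q (p.1 1) (p.2 1) (conj (w 1)) (z 1)

lemma dualHeat_exponent {θ q : ℝ} (hq : q < 1) (k l : ℤ) (W Z : ℂ) :
    -(2 * Real.pi / θ / 2 * (1 / 2 * (k ^ 2 + l ^ 2)) * ((1 + q) / (1 - q)))
      + (-(2 * Real.pi / θ) * (1 / 2 * (k ^ 2 + l ^ 2)) / 2
        - 2 * Real.pi / θ * (-I * (k + -I * l) / (Real.sqrt 2 : ℂ) * Z)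
        + 2 * Real.pi / θ * (W * (Z + I * (k + I * l) / (Real.sqrt 2 : ℂ)))) =
    2 * Real.pi / θ * (q * (W * Z)) +
      (-Real.pi / (θ * (1 - q) : ℝ) * (k + I * (-(1 - q) * (W + Z) / (Real.sqrt 2 : ℂ))) ^ 2 +
      -Real.pi / (θ * (1 - q) : ℝ) * (l + I * (-I * (1 - q) * (W - Z) / (Real.sqrt 2 : ℂ))) ^ 2) := by
  have hr := inv_ofReal_sqrt_two_sq
  have hu : (1 - q : ℂ)⁻¹ * (1 - q) = 1 :=
    inv_mul_cancel₀ (by exact_mod_cast (sub_pos.2 hq).ne')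
  push_cast
  simp only [div_eq_mul_inv, mul_inv]
  generalize ((Real.sqrt 2 : ℝ) : ℂ)⁻¹ = r at hr ⊢
  generalize (1 - q : ℂ)⁻¹ = u at hu ⊢
  generalize (θ : ℂ)⁻¹ = t
  linear_combination (Real.pi * t / 2 * (k ^ 2 + l ^ 2)
      - 2 * Real.pi * t * r * I * (k * (W + Z) + I * l * (W - Z))
      - 2 * Real.pi * t * (1 - q) * (W * Z)) * hu
    - Real.pi * t * u * (1 - q) ^ 2 * ((W + Z) ^ 2 + I ^ 2 * (W - Z) ^ 2) * hr
    + (Real.pi * t * u * (1 - q) ^ 2 * r ^ 2 * ((W + Z) ^ 2 + I ^ 2 * (W - Z) ^ 2)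
      - Real.pi * t * u * (1 - q) ^ 2 / 2 * (W - Z) ^ 2) * I_sq

/-- The dual kernel as a product over the coordinates, in the form in which it comes out of
one-dimensional Poisson summation and Fourier transformation. -/
lemma dualHeat_eq {θ q : ℝ} (hθ : 0 < θ) (hq : q < 1) (k : Label) (z w : Phase) :
    dualHeat θ q k z w = cexp (freq θ * (q * cdot w z)) *
      ((∏ i, (1 / (Real.sqrt (θ * (1 - q)) : ℂ) *
          cexp (-Real.pi / (θ * (1 - q) : ℝ) * (k.1 i + I * reShift q z w i) ^ 2))) *
        ∏ i, (1 / (Real.sqrt (θ * (1 - q)) : ℂ) *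
          cexp (-Real.pi / (θ * (1 - q) : ℝ) * (k.2 i + I * imShift q z w i) ^ 2))) := by
  have ha : 0 < θ * (1 - q) := mul_pos hθ (by linarith)
  have hc : ((1 / θ ^ 2 * (1 / (1 - q) ^ 2) : ℝ) : ℂ) =
      (1 / (Real.sqrt (θ * (1 - q)) : ℂ)) ^ 4 := by
    rw [← ofReal_one, ← ofReal_div, ← ofReal_pow]
    congr 1
    rw [div_pow, show Real.sqrt (θ * (1 - q)) ^ 4 = (Real.sqrt (θ * (1 - q)) ^ 2) ^ 2 by ring,
      Real.sq_sqrt ha.le, mul_pow]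
    field_simp
  have e : ∀ c a₀ b₀ a₁ b₁ g : ℂ, g * (c * a₀ * (c * a₁) * (c * b₀ * (c * b₁))) =
      c ^ 4 * (g * (a₀ * b₀ * (a₁ * b₁))) := by intros; ring
  rw [dualHeat, translationKernel, idKernel, ← mul_assoc (1 / θ ^ 2), ofReal_mul, ofReal_exp, hc,
    nsq_dualPoint]
  simp only [Fin.prod_univ_two]
  rw [e, mul_assoc]
  congr 1
  simp only [← Complex.exp_add, cdot, Fin.sum_univ_two, labelSq,
    dualPoint, Pi.add_apply, map_add, map_mul, map_div₀, map_intCast, conj_ofReal, conj_I, reShift,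
    imShift, ofReal_freq]
  congr 1
  have e0 := dualHeat_exponent (θ := θ) hq (k.1 0) (k.2 0) (conj (w 0)) (z 0)
  have e1 := dualHeat_exponent (θ := θ) hq (k.1 1) (k.2 1) (conj (w 1)) (z 1)
  push_cast at e0 e1 ⊢
  rw [ofReal_freq]
  linear_combination e0 + e1

lemma ofReal_cpow_half {a : ℝ} (ha : 0 < a) : (a : ℂ) ^ (1 / 2 : ℂ) = (Real.sqrt a : ℂ) := by
  rw [Real.sqrt_eq_rpow, ofReal_cpow ha.le]
  push_cast; rfl

lemma summable_cexp_dual_quadratic {a : ℝ} (ha : 0 < a) (b : ℂ) :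
    Summable fun k : ℤ => cexp (-Real.pi / a * (k + I * b) ^ 2) := by
  have := (summable_cexp_quadratic (inv_pos.2 ha) (-I * b / a)).mul_left
    (cexp (Real.pi / a * b ^ 2))
  refine this.congr fun k => ?_
  rw [← Complex.exp_add]
  congr 1
  have hI : I ^ 2 = -1 := I_sq
  push_cast
  ring_nf
  simp only [hI]
  ring

lemma tsum_cexp_quadratic {a : ℝ} (ha : 0 < a) (b : ℂ) :
    ∑' n : ℤ, cexp (-Real.pi * a * n ^ 2 + 2 * Real.pi * b * n) =
      ∑' k : ℤ, (1 / (Real.sqrt a : ℂ) * cexp (-Real.pi / a * (k + I * b) ^ 2)) := by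
  rw [Complex.tsum_exp_neg_quadratic (by simpa using ha), tsum_mul_left, ofReal_cpow_half ha]

/-- Poisson summation over the lattice. -/
lemma hasSum_dualHeat {θ q : ℝ} (hθ : 0 < θ) (hq : q < 1) (z w : Phase) :
    HasSum (fun k : Label => dualHeat θ q k z w)
      (∑' γ : Label, conjugatedHeat θ q (latticePoint θ γ) z w) := by
  have ha : 0 < θ * (1 - q) := mul_pos hθ (by linarith)
  have h1 := (hasSum_label_prod (fun i => summable_cexp_quadratic ha (reShift q z w i))
    (fun i => summable_cexp_quadratic ha (imShift q z w i))).mul_left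
      (cexp (freq θ * (q * cdot w z)))
  have h2 := (hasSum_label_prod
    (fun i => (summable_cexp_dual_quadratic ha (reShift q z w i)).mul_left
      (1 / (Real.sqrt (θ * (1 - q)) : ℂ)))
    (fun i => (summable_cexp_dual_quadratic ha (imShift q z w i)).mul_left
      (1 / (Real.sqrt (θ * (1 - q)) : ℂ)))).mul_left
      (cexp (freq θ * (q * cdot w z)))
  simp only [← dualHeat_eq hθ hq, ← tsum_cexp_quadratic ha] at h2
  convert! h2 using 1
  rw [← h1.tsum_eq]
  refine tsum_congr fun γ => ?_
  rw [latticePoint, conjugatedHeat_phasePoint hθ]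
  simp only [ofReal_intCast]

lemma integral_fourier_quadratic {a : ℝ} (ha : 0 < a) (b k : ℂ) :
    ∫ x : ℝ, cexp (-(2 * Real.pi * I) * (k * x)) *
      cexp (-Real.pi * a * x ^ 2 + 2 * Real.pi * b * x) =
      1 / (Real.sqrt a : ℂ) * cexp (-Real.pi / a * (k + I * b) ^ 2) := by
  have hπ : (Real.pi : ℂ) ≠ 0 := by exact_mod_cast Real.pi_ne_zero
  have ha' : (a : ℂ) ≠ 0 := by exact_mod_cast ha.ne'
  have h := integral_cexp_quadratic (b := ((-(Real.pi * a) : ℝ) : ℂ))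
    (by rw [ofReal_re]; have := Real.pi_pos; nlinarith [mul_pos this ha])
    (2 * Real.pi * b - 2 * Real.pi * I * k) 0
  rw [show (Real.pi : ℂ) / -((-(Real.pi * a) : ℝ) : ℂ) = ((a⁻¹ : ℝ) : ℂ) by
    push_cast; field_simp, ofReal_cpow_half (inv_pos.2 ha), Real.sqrt_inv] at h
  rw [one_div, ← ofReal_inv]
  convert! h using 1
  · refine integral_congr_ae (Eventually.of_forall fun x => ?_)
    simp only [← Complex.exp_add]
    congr 1
    push_cast
    ring
  · congr 2
    push_cast
    field_simp
    have hI : I ^ 2 = -1 := I_sq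
    ring_nf
    simp only [hI]
    ring

lemma integral_fourier_conjugatedHeat {θ q : ℝ} (hθ : 0 < θ) (hq : q < 1) (k : Label)
    (z w : Phase) :
    ∫ p : (Fin 2 → ℝ) × (Fin 2 → ℝ), cexp (-(2 * Real.pi * I) *
        ∑ i, ((k.1 i : ℂ) * (p.1 i : ℂ) + (k.2 i : ℂ) * (p.2 i : ℂ))) *
      conjugatedHeat θ q (phasePoint θ p) z w = dualHeat θ q k z w := by
  have ha : 0 < θ * (1 - q) := mul_pos hθ (by linarith)
  rw [dualHeat_eq hθ hq]
  simp only [← integral_fourier_quadratic ha]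
  rw [← integral_fintype_prod_volume_eq_prod, ← integral_fintype_prod_volume_eq_prod,
    ← integral_prod_mul, ← integral_const_mul]
  refine integral_congr_ae (Eventually.of_forall fun p => ?_)
  simp only [conjugatedHeat_phasePoint hθ, Fin.prod_univ_two, Fin.sum_univ_two,
    ← Complex.exp_add]
  congr 1
  ring

/-! ### The graphs as sums of modes -/

/-- The kernel of the translation by `v`, with the coefficient it acquires in a graph of total
strength `A`. -/
noncomputable def modeKernel (θ μ₀ A ε : ℝ) (v z w : Phase) : ℂ :=
  (A * modeCoeff θ μ₀ (nsq v) ε : ℝ) * translationKernel θ v z w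

section
variable {θ μ₀ ε : ℝ}

lemma decay_pos (hθ : 0 < θ) (hε : 0 < ε) : 0 < freq θ * decayRate θ ε / 4 := by
  have := freq_pos hθ
  have := decayRate_pos hθ hε
  positivity

lemma loopMode_eq (hθ : 0 < θ) (hμ₀ : μ₀ ≠ 0) (hε : 0 < ε) (lam : ℝ) (γ : Label) :
    loopMode θ lam μ₀ ε γ = modeKernel θ μ₀ lam ε (latticePoint θ γ) := by
  ext z₁ z₂
  exact loopGraph_vertexMode hθ hμ₀ hε lam _ z₁ z₂

lemma hasSum_loopGraph (hθ : 0 < θ) (hμ₀ : μ₀ ≠ 0) (hε : 0 < ε) (lam : ℝ) (z₁ z₂ : Phase) :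
    HasSum (fun γ : Label => modeKernel θ μ₀ lam ε (latticePoint θ γ) z₁ z₂)
      (loopGraph θ μ₀ ε (vertex θ lam) z₁ z₂) := by
  have hG := gaussianVertex_loop hθ (decayRate_pos hθ hε).le decayRate_le_one lam z₁ z₂
  have h := (hG.hasSum_integral hθ hε hμ₀
    (summable_exp_nsq_latticePoint hθ (decay_pos hθ hε))).mul_left 2
  refine h.congr_fun fun γ => ?_
  rw [← loopMode_eq hθ hμ₀ hε]
  rfl

/-- The family of conjugated heat kernels is dominated by a Gaussian in the translation vector,
uniformly above the cut-off. -/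
lemma exists_bound_conjugatedHeat (hθ : 0 < θ) (hε : 0 < ε) (μ₀ : ℝ) (z w : Phase) :
    ∃ C, ∀ β, ε ≤ β → ∀ v, ‖(Real.exp (-(μ₀ ^ 2 / 2) * β) : ℂ) *
      conjugatedHeat θ (Real.exp (-β * freq θ)) v z w‖ ≤
        Real.exp (-(freq θ * decayRate θ ε / 4) * nsq v) *
          (Real.exp (-(μ₀ ^ 2 / 2) * β) * C) := by
  have hG := gaussianVertex_line hθ (decayRate_pos hθ hε).le decayRate_le_one 2 z w
  refine ⟨vertexConst θ 2 (decayRate θ ε) z w *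
    ∫ p, loopWeight θ ε p ∂(gauss θ).prod (gauss θ), fun β hβ v => ?_⟩
  have h := hG.norm_integral_heatKernel_le hθ hε μ₀ hβ v
  rw [integral_line_heatKernel hθ (hε.trans_le hβ)] at h
  simpa using h

lemma continuous_conjugatedHeat {X : Type*} [TopologicalSpace X] (θ : ℝ) {q : X → ℝ}
    {v : X → Phase} (hq : Continuous q) (hv : Continuous v) (z w : Phase) :
    Continuous fun x => conjugatedHeat θ (q x) (v x) z w := by
  unfold conjugatedHeat cdot
  simp only [Pi.add_apply]
  fun_prop

lemma hasSum_lineGraph_lattice (hθ : 0 < θ) (hμ₀ : μ₀ ≠ 0) (hε : 0 < ε) (lam : ℝ)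
    (z₁ z₂ : Phase) :
    HasSum (fun γ : Label => lineGraph θ μ₀ ε (vertexMode θ lam (latticePoint θ γ)) z₁ z₂)
      (lineGraph θ μ₀ ε (vertex θ lam) z₁ z₂) := by
  have hG := gaussianVertex_line hθ (decayRate_pos hθ hε).le decayRate_le_one lam z₁ z₂
  exact (hG.hasSum_integral hθ hε hμ₀
    (summable_exp_nsq_latticePoint hθ (decay_pos hθ hε))).mul_left 2

lemma hasSum_integral_conjugatedHeat (hθ : 0 < θ) (hμ₀ : μ₀ ≠ 0) (hε : 0 < ε) (z w : Phase) :
    HasSum (fun γ : Label => ∫ β in Set.Ioi ε, (Real.exp (-(μ₀ ^ 2 / 2) * β) : ℂ) *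
        conjugatedHeat θ (Real.exp (-β * freq θ)) (latticePoint θ γ) z w)
      (∫ β in Set.Ioi ε, ∑' γ : Label, (Real.exp (-(μ₀ ^ 2 / 2) * β) : ℂ) *
        conjugatedHeat θ (Real.exp (-β * freq θ)) (latticePoint θ γ) z w) := by
  obtain ⟨C, hC⟩ := exists_bound_conjugatedHeat hθ hε μ₀ z w
  have hbound : ∀ γ : Label, ∀ᵐ β ∂volume.restrict (Set.Ioi ε),
      ‖(Real.exp (-(μ₀ ^ 2 / 2) * β) : ℂ) *
        conjugatedHeat θ (Real.exp (-β * freq θ)) (latticePoint θ γ) z w‖ ≤ _ := fun γ =>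
    (ae_restrict_iff' measurableSet_Ioi).2 (Eventually.of_forall fun β hβ =>
      hC β (le_of_lt hβ) (latticePoint θ γ))
  have hdom : ∀ v : Phase, Integrable (fun β => Real.exp (-(freq θ * decayRate θ ε / 4) * nsq v) *
      (Real.exp (-(μ₀ ^ 2 / 2) * β) * C)) (volume.restrict (Set.Ioi ε)) := fun v =>
    ((integrableOn_exp_mass hμ₀ ε).mul_const C).const_mul _
  refine hasSum_integral_of_summable_integral_norm (fun γ => ?_) ?_
  · refine (hdom _).mono' (Continuous.aestronglyMeasurable ?_) (hbound γ)
    exact Continuous.mul (by fun_prop)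
      (continuous_conjugatedHeat θ (by fun_prop) continuous_const z w)
  · refine Summable.of_nonneg_of_le (fun γ => integral_nonneg fun β => norm_nonneg _) (fun γ => ?_)
      ((summable_exp_nsq_latticePoint hθ (decay_pos hθ hε)).mul_right
        (∫ β in Set.Ioi ε, Real.exp (-(μ₀ ^ 2 / 2) * β) * C))
    rw [← integral_const_mul]
    exact integral_mono_of_nonneg (Eventually.of_forall fun β => norm_nonneg _) (hdom _) (hbound γ)

/-- The coefficient of a dual mode at fixed proper time is that of a mode of the closed loop. -/
lemma exp_mul_dualHeat (θ μ₀ β : ℝ) (k : Label) (z w : Phase) :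
    (Real.exp (-(μ₀ ^ 2 / 2) * β) : ℂ) * dualHeat θ (Real.exp (-β * freq θ)) k z w =
      ((1 / θ ^ 2 * modeIntegrand θ μ₀ (nsq (dualPoint k)) β : ℝ) : ℂ) *
        translationKernel θ (dualPoint k) z w := by
  rw [dualHeat, modeIntegrand]
  push_cast
  ring

lemma half_integral_exp_mul_dualHeat (θ lam μ₀ ε : ℝ) (k : Label) (z w : Phase) :
    lam * (1 / 2 * ∫ β in Set.Ioi ε, (Real.exp (-(μ₀ ^ 2 / 2) * β) : ℂ) *
      dualHeat θ (Real.exp (-β * freq θ)) k z w) =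
      modeKernel θ μ₀ (lam * (1 / θ ^ 2)) ε (dualPoint k) z w := by
  simp only [exp_mul_dualHeat]
  rw [integral_mul_const, integral_complex_ofReal, integral_const_mul, modeKernel, modeCoeff]
  push_cast
  ring

lemma hasSum_integral_dualHeat (hθ : 0 < θ) (hμ₀ : μ₀ ≠ 0) (hε : 0 < ε) (z w : Phase) :
    HasSum (fun k : Label => ∫ β in Set.Ioi ε, (Real.exp (-(μ₀ ^ 2 / 2) * β) : ℂ) *
        dualHeat θ (Real.exp (-β * freq θ)) k z w)
      (∫ β in Set.Ioi ε, ∑' k : Label, (Real.exp (-(μ₀ ^ 2 / 2) * β) : ℂ) *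
        dualHeat θ (Real.exp (-β * freq θ)) k z w) := by
  have hω := freq_pos hθ
  simp only [exp_mul_dualHeat]
  have hint : ∀ k : Label, IntegrableOn (fun β =>
      1 / θ ^ 2 * modeIntegrand θ μ₀ (nsq (dualPoint k)) β) (Set.Ioi ε) := fun k =>
    (integrableOn_modeIntegrand hθ hμ₀ hε (nsq_nonneg _)).const_mul _
  refine hasSum_integral_of_summable_integral_norm
    (fun k => (hint k).ofReal.mul_const _) ?_
  simp only [norm_mul, norm_real, integral_mul_const, norm_div, norm_pow, integral_const_mul]
  refine Summable.of_nonneg_of_le (fun k => ?_) (fun k => ?_)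
    (((summable_exp_nsq_dualPoint (b := freq θ / 4) (by positivity)).mul_left
      (‖(1 : ℝ)‖ / ‖θ‖ ^ 2 * ((∫ β in Set.Ioi ε, Real.exp (-(μ₀ ^ 2 / 2) * β)) *
        (1 / (1 - Real.exp (-ε * freq θ)) ^ 2)))).mul_right
        (Real.exp (freq θ / 2 * nsq z) * Real.exp (freq θ / 2 * nsq w)))
  · exact mul_nonneg (mul_nonneg (by positivity) (integral_nonneg fun β => norm_nonneg _))
      (norm_nonneg _)
  · simp only [Real.norm_of_nonneg (modeIntegrand_nonneg _ _ _ _)]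
    have h1 := integral_modeIntegrand_le_of_pos hθ hμ₀ hε (nsq_nonneg (dualPoint k))
    rw [← neg_mul (freq θ / 4)] at h1
    have h2 := norm_translationKernel_le hθ (dualPoint k) z w
    rw [mul_assoc (‖(1 : ℝ)‖ / ‖θ‖ ^ 2) _ (Real.exp _)]
    refine mul_le_mul (mul_le_mul_of_nonneg_left h1 (by positivity)) h2 (norm_nonneg _) ?_
    exact mul_nonneg (by positivity) ((integral_nonneg fun β => modeIntegrand_nonneg _ _ _ _).trans h1)

/-- The graph without a closed loop, Poisson resummed at each proper time. -/
lemma hasSum_lineGraph (hθ : 0 < θ) (hμ₀ : μ₀ ≠ 0) (hε : 0 < ε) (lam : ℝ) (z₁ z₂ : Phase) :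
    HasSum (fun k : Label => modeKernel θ μ₀ (lam * (1 / θ ^ 2)) ε (dualPoint k) z₁ z₂)
      (lineGraph θ μ₀ ε (vertex θ lam) z₁ z₂) := by
  have h1 := ((hasSum_integral_conjugatedHeat hθ hμ₀ hε z₁ z₂).mul_left (1 / 2)).mul_left (lam : ℂ)
  have h2 := ((hasSum_integral_dualHeat hθ hμ₀ hε z₁ z₂).mul_left (1 / 2)).mul_left (lam : ℂ)
  have h3 := hasSum_lineGraph_lattice hθ hμ₀ hε lam z₁ z₂
  simp only [lineGraph_vertexMode hθ hμ₀ hε] at h3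
  simp only [half_integral_exp_mul_dualHeat] at h2
  rw [h3.unique h1]
  convert! h2 using 3
  refine setIntegral_congr_fun measurableSet_Ioi fun β hβ => ?_
  have := hasSum_dualHeat hθ (exp_cutoff_lt_one hθ (hε.trans hβ)) z₁ z₂
  simp only [tsum_mul_left]
  rw [this.tsum_eq]

lemma continuous_phasePoint (θ : ℝ) : Continuous (phasePoint θ) := by
  unfold phasePoint
  fun_prop

lemma integrable_exp_nsq_phasePoint {b : ℝ} (hθ : 0 < θ) (hb : 0 < b) :
    Integrable fun p => Real.exp (-b * nsq (phasePoint θ p)) := by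
  have hb' : 0 < b * (θ ^ 2 / 2) := by positivity
  have h : Integrable fun x : Fin 2 → ℝ => Real.exp (-(b * (θ ^ 2 / 2)) * ∑ i, x i ^ 2) := by
    have := (GaussianFourier.integrable_cexp_neg_mul_sum_add (ι := Fin 2)
      (b := ((b * (θ ^ 2 / 2) : ℝ) : ℂ)) (by rwa [ofReal_re]) 0).norm
    refine this.congr (Eventually.of_forall fun x => ?_)
    simp only [Complex.norm_exp, Pi.zero_apply, zero_mul, Finset.sum_const_zero, add_zero]
    norm_cast
  refine (h.mul_prod h).congr (Eventually.of_forall fun p => ?_)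
  simp only [← Real.exp_add, nsq_phasePoint, Finset.sum_add_distrib]
  congr 1
  ring

/-- The Fourier phase at the label `k`. -/
noncomputable def fourierPhase (k : Label) (p : (Fin 2 → ℝ) × (Fin 2 → ℝ)) : ℂ :=
  cexp (-(2 * Real.pi * I) * ∑ i, ((k.1 i : ℂ) * (p.1 i : ℂ) + (k.2 i : ℂ) * (p.2 i : ℂ)))

lemma norm_fourierPhase (k : Label) (p : (Fin 2 → ℝ) × (Fin 2 → ℝ)) : ‖fourierPhase k p‖ = 1 := by
  have := norm_exp_ofReal_mul_I (-(2 * Real.pi) * ∑ i, ((k.1 i : ℝ) * p.1 i + (k.2 i : ℝ) * p.2 i))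
  rw [← this, fourierPhase]
  congr 2
  push_cast
  ring

lemma continuous_fourierPhase (k : Label) : Continuous (fourierPhase k) := by
  unfold fourierPhase
  fun_prop

lemma integrable_fourier_conjugatedHeat (hθ : 0 < θ) (hμ₀ : μ₀ ≠ 0) (hε : 0 < ε) (k : Label)
    (z w : Phase) :
    Integrable (fun x : ((Fin 2 → ℝ) × (Fin 2 → ℝ)) × ℝ => fourierPhase k x.1 *
      ((Real.exp (-(μ₀ ^ 2 / 2) * x.2) : ℂ) *
        conjugatedHeat θ (Real.exp (-x.2 * freq θ)) (phasePoint θ x.1) z w))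
      (volume.prod (volume.restrict (Set.Ioi ε))) := by
  obtain ⟨C, hC⟩ := exists_bound_conjugatedHeat hθ hε μ₀ z w
  refine ((integrable_exp_nsq_phasePoint hθ (decay_pos hθ hε)).mul_prod
    ((integrableOn_exp_mass hμ₀ ε).mul_const C)).mono' (Continuous.aestronglyMeasurable ?_) ?_
  · exact ((continuous_fourierPhase k).comp continuous_fst).mul (Continuous.mul (by fun_prop)
      (continuous_conjugatedHeat θ (by fun_prop)
        ((continuous_phasePoint θ).comp continuous_fst) z w))
  · have : ∀ᵐ x : ((Fin 2 → ℝ) × (Fin 2 → ℝ)) × ℝ ∂(volume.prod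
        (volume.restrict (Set.Ioi ε))), x.2 ∈ Set.Ioi ε :=
      Measure.quasiMeasurePreserving_snd.ae (ae_restrict_mem measurableSet_Ioi)
    filter_upwards [this] with x hx
    rw [norm_mul, norm_fourierPhase, one_mul]
    exact hC x.2 (le_of_lt hx) _

lemma dualIntegrand_eq (hθ : 0 < θ) (hμ₀ : μ₀ ≠ 0) (hε : 0 < ε) (lam : ℝ) (k : Label)
    (z₁ z₂ : Phase) :
    dualIntegrand θ lam μ₀ ε k z₁ z₂ = fun p => lam * (1 / 2 * ∫ β in Set.Ioi ε,
      fourierPhase k p * ((Real.exp (-(μ₀ ^ 2 / 2) * β) : ℂ) *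
        conjugatedHeat θ (Real.exp (-β * freq θ)) (phasePoint θ p) z₁ z₂)) := by
  ext p
  rw [dualIntegrand, lineGraph_vertexMode hθ hμ₀ hε, integral_const_mul, fourierPhase]
  ring

lemma integrable_dualIntegrand (hθ : 0 < θ) (hμ₀ : μ₀ ≠ 0) (hε : 0 < ε) (lam : ℝ) (k : Label)
    (z₁ z₂ : Phase) : Integrable (dualIntegrand θ lam μ₀ ε k z₁ z₂) := by
  rw [dualIntegrand_eq hθ hμ₀ hε]
  exact ((integrable_fourier_conjugatedHeat hθ hμ₀ hε k z₁ z₂).integral_prod_left.const_mul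
    _).const_mul _

/-- Fubini exchanges the Fourier transform with the proper-time integral. -/
lemma dualMode_eq (hθ : 0 < θ) (hμ₀ : μ₀ ≠ 0) (hε : 0 < ε) (lam : ℝ) (k : Label) :
    dualMode θ lam μ₀ ε k = modeKernel θ μ₀ (lam * (1 / θ ^ 2)) ε (dualPoint k) := by
  ext z₁ z₂
  rw [dualMode, dualIntegrand_eq hθ hμ₀ hε, integral_const_mul, integral_const_mul,
    integral_integral_swap (integrable_fourier_conjugatedHeat hθ hμ₀ hε k z₁ z₂),
    ← half_integral_exp_mul_dualHeat]
  congr 2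
  refine setIntegral_congr_fun measurableSet_Ioi fun β hβ => ?_
  rw [← integral_fourier_conjugatedHeat hθ (exp_cutoff_lt_one hθ (hε.trans hβ)),
    ← integral_const_mul]
  refine integral_congr_ae (Eventually.of_forall fun p => ?_)
  simp only [fourierPhase]
  ring

end

/-! ### Evaluation of the modes in external fields -/

/-- Integrability of a field against the square root of the Gaussian weight: the space in which
translation kernels are bounded forms, uniformly in the translation vector. -/
def WeightIntegrable (θ : ℝ) (φ : Phase → ℂ) : Prop :=
  Integrable (fun z => (Real.exp (freq θ / 2 * nsq z) : ℂ) * φ z) (gauss θ)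

/-- The product of the two weighted external fields. -/
noncomputable def fieldWeight (θ : ℝ) (φ₁ φ₂ : Phase → ℂ) (p : Phase × Phase) : ℂ :=
  conj ((Real.exp (freq θ / 2 * nsq p.1) : ℂ) * φ₁ p.1) *
    ((Real.exp (freq θ / 2 * nsq p.2) : ℂ) * φ₂ p.2)

section
variable {θ μ₀ ε : ℝ} {φ₁ φ₂ : Phase → ℂ}

lemma integrable_fieldWeight (h₁ : WeightIntegrable θ φ₁) (h₂ : WeightIntegrable θ φ₂) :
    Integrable (fieldWeight θ φ₁ φ₂) ((gauss θ).prod (gauss θ)) := by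
  have h₁' : Integrable (fun z => conj ((Real.exp (freq θ / 2 * nsq z) : ℂ) * φ₁ z)) (gauss θ) :=
    (conjCLE : ℂ →L[ℝ] ℂ).integrable_comp h₁
  exact h₁'.mul_prod h₂

lemma smearIntegrand_translationKernel (θ : ℝ) (φ₁ φ₂ : Phase → ℂ) (v : Phase) (p : Phase × Phase) :
    smearIntegrand (translationKernel θ v) φ₁ φ₂ p =
      ((Real.exp (-(freq θ / 2 * nsq p.1)) * Real.exp (-(freq θ / 2 * nsq p.2)) : ℝ) : ℂ) *
        translationKernel θ v p.1 p.2 * fieldWeight θ φ₁ φ₂ p := by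
  rw [fieldWeight, smearIntegrand, map_mul, conj_ofReal, Real.exp_neg, Real.exp_neg]
  have h : ∀ x : ℝ, (Real.exp x : ℂ) ≠ 0 := fun x => by exact_mod_cast (Real.exp_pos x).ne'
  have h1 := h (freq θ / 2 * nsq p.1)
  have h2 := h (freq θ / 2 * nsq p.2)
  push_cast at h1 h2 ⊢
  field_simp

lemma norm_weighted_translationKernel_le (hθ : 0 < θ) (v : Phase) (p : Phase × Phase) :
    ‖((Real.exp (-(freq θ / 2 * nsq p.1)) * Real.exp (-(freq θ / 2 * nsq p.2)) : ℝ) : ℂ) *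
        translationKernel θ v p.1 p.2‖ ≤ 1 := by
  rw [norm_mul, norm_real, Real.norm_of_nonneg (by positivity)]
  refine (mul_le_mul_of_nonneg_left (norm_translationKernel_le hθ v p.1 p.2)
    (by positivity)).trans_eq ?_
  simp only [← Real.exp_add]
  rw [Real.exp_eq_one_iff]
  ring

lemma norm_smearIntegrand_translationKernel_le (hθ : 0 < θ) (v : Phase) (p : Phase × Phase) :
    ‖smearIntegrand (translationKernel θ v) φ₁ φ₂ p‖ ≤ ‖fieldWeight θ φ₁ φ₂ p‖ := by
  rw [smearIntegrand_translationKernel, norm_mul]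
  exact mul_le_of_le_one_left (norm_nonneg _) (norm_weighted_translationKernel_le hθ v p)

lemma integrable_smear_translationKernel (hθ : 0 < θ) (h₁ : WeightIntegrable θ φ₁)
    (h₂ : WeightIntegrable θ φ₂) (v : Phase) :
    Integrable (smearIntegrand (translationKernel θ v) φ₁ φ₂) ((gauss θ).prod (gauss θ)) := by
  refine ((integrable_fieldWeight h₁ h₂).bdd_mul (c := 1)
    (Continuous.aestronglyMeasurable ?_)
    (Eventually.of_forall fun p => norm_weighted_translationKernel_le hθ v p)).congr
    (Eventually.of_forall fun p => (smearIntegrand_translationKernel θ φ₁ φ₂ v p).symm)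
  exact Continuous.mul (by fun_prop)
    (continuous_translationKernel θ continuous_const continuous_fst continuous_snd)

lemma norm_smear_translationKernel_le (hθ : 0 < θ) (h₁ : WeightIntegrable θ φ₁)
    (h₂ : WeightIntegrable θ φ₂) (v : Phase) :
    ‖smear θ (translationKernel θ v) φ₁ φ₂‖ ≤
      ∫ p, ‖fieldWeight θ φ₁ φ₂ p‖ ∂(gauss θ).prod (gauss θ) :=
  norm_integral_le_of_norm_le (integrable_fieldWeight h₁ h₂).norm
    (Eventually.of_forall fun p => norm_smearIntegrand_translationKernel_le hθ v p)

lemma smearIntegrand_modeKernel (θ μ₀ A ε : ℝ) (v : Phase) :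
    smearIntegrand (modeKernel θ μ₀ A ε v) φ₁ φ₂ = fun p =>
      ((A * modeCoeff θ μ₀ (nsq v) ε : ℝ) : ℂ) *
        smearIntegrand (translationKernel θ v) φ₁ φ₂ p := by
  ext p
  simp only [smearIntegrand, modeKernel]
  ring

lemma smear_modeKernel (θ μ₀ A ε : ℝ) (v : Phase) :
    smear θ (modeKernel θ μ₀ A ε v) φ₁ φ₂ =
      ((A * modeCoeff θ μ₀ (nsq v) ε : ℝ) : ℂ) * smear θ (translationKernel θ v) φ₁ φ₂ := by
  rw [smear, smearIntegrand_modeKernel, integral_const_mul, smear]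

lemma integrable_smear_modeKernel (hθ : 0 < θ) (h₁ : WeightIntegrable θ φ₁)
    (h₂ : WeightIntegrable θ φ₂) (μ₀ A ε : ℝ) (v : Phase) :
    Integrable (smearIntegrand (modeKernel θ μ₀ A ε v) φ₁ φ₂) ((gauss θ).prod (gauss θ)) := by
  rw [smearIntegrand_modeKernel]
  exact (integrable_smear_translationKernel hθ h₁ h₂ v).const_mul _

variable {v : Label → Phase}

lemma summable_modeCoeff (hθ : 0 < θ) (hμ₀ : μ₀ ≠ 0) (hε : 0 < ε)
    (hv : Summable fun γ => Real.exp (-(freq θ / 4) * nsq (v γ))) (A : ℝ) :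
    Summable fun γ => |A * modeCoeff θ μ₀ (nsq (v γ)) ε| := by
  obtain ⟨K, hK⟩ := modeCoeff_le_of_pos hθ hμ₀ hε
  refine Summable.of_nonneg_of_le (fun γ => abs_nonneg _) (fun γ => ?_)
    ((hv.mul_left K).mul_left |A|)
  rw [abs_mul, abs_of_nonneg (modeCoeff_nonneg _ _ _ _), neg_mul]
  exact mul_le_mul_of_nonneg_left (hK _ (nsq_nonneg _)) (abs_nonneg _)

lemma norm_smearIntegrand_modeKernel_le (hθ : 0 < θ) (μ₀ A ε : ℝ) (w : Phase)
    (p : Phase × Phase) :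
    ‖smearIntegrand (modeKernel θ μ₀ A ε w) φ₁ φ₂ p‖ ≤
      |A * modeCoeff θ μ₀ (nsq w) ε| * ‖fieldWeight θ φ₁ φ₂ p‖ := by
  rw [smearIntegrand_modeKernel, norm_mul, norm_real, Real.norm_eq_abs]
  exact mul_le_mul_of_nonneg_left (norm_smearIntegrand_translationKernel_le hθ w p) (abs_nonneg _)

variable {A : ℝ} {G : Phase → Phase → ℂ}

lemma hasSum_smearIntegrand
    (hG : ∀ z w, HasSum (fun γ => modeKernel θ μ₀ A ε (v γ) z w) (G z w)) (p : Phase × Phase) :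
    HasSum (fun γ => smearIntegrand (modeKernel θ μ₀ A ε (v γ)) φ₁ φ₂ p)
      (smearIntegrand G φ₁ φ₂ p) :=
  (hG p.1 p.2).mul_left _

lemma integrable_smear_of_hasSum (hθ : 0 < θ) (hμ₀ : μ₀ ≠ 0) (hε : 0 < ε)
    (h₁ : WeightIntegrable θ φ₁) (h₂ : WeightIntegrable θ φ₂)
    (hv : Summable fun γ => Real.exp (-(freq θ / 4) * nsq (v γ)))
    (hG : ∀ z w, HasSum (fun γ => modeKernel θ μ₀ A ε (v γ) z w) (G z w)) :
    Integrable (smearIntegrand G φ₁ φ₂) ((gauss θ).prod (gauss θ)) := by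
  have hs := summable_modeCoeff hθ hμ₀ hε hv A
  refine Integrable.mono' ((integrable_fieldWeight h₁ h₂).norm.const_mul
    (∑' γ, |A * modeCoeff θ μ₀ (nsq (v γ)) ε|)) ?_ (Eventually.of_forall fun p => ?_)
  · refine aestronglyMeasurable_of_tendsto_ae atTop
      (f := fun s p => ∑ γ ∈ s, smearIntegrand (modeKernel θ μ₀ A ε (v γ)) φ₁ φ₂ p)
      (fun s => ?_) (Eventually.of_forall fun p => hasSum_smearIntegrand hG p)
    exact (integrable_finsetSum s fun γ _ =>
      integrable_smear_modeKernel hθ h₁ h₂ μ₀ A ε (v γ)).aestronglyMeasurable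
  · rw [← (hasSum_smearIntegrand hG p).tsum_eq, ← tsum_mul_right]
    exact tsum_of_norm_bounded (hs.mul_right _).hasSum
      fun γ => norm_smearIntegrand_modeKernel_le hθ μ₀ A ε (v γ) p

lemma hasSum_smear_of_hasSum (hθ : 0 < θ) (hμ₀ : μ₀ ≠ 0) (hε : 0 < ε)
    (h₁ : WeightIntegrable θ φ₁) (h₂ : WeightIntegrable θ φ₂)
    (hv : Summable fun γ => Real.exp (-(freq θ / 4) * nsq (v γ)))
    (hG : ∀ z w, HasSum (fun γ => modeKernel θ μ₀ A ε (v γ) z w) (G z w)) :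
    HasSum (fun γ => smear θ (modeKernel θ μ₀ A ε (v γ)) φ₁ φ₂) (smear θ G φ₁ φ₂) := by
  have hs := summable_modeCoeff hθ hμ₀ hε hv A
  have h := hasSum_integral_of_summable_integral_norm
    (fun γ => integrable_smear_modeKernel hθ h₁ h₂ μ₀ A ε (v γ)) (by
      refine Summable.of_nonneg_of_le (fun γ => integral_nonneg fun p => norm_nonneg _)
        (fun γ => ?_) (hs.mul_right
          (∫ p, ‖fieldWeight θ φ₁ φ₂ p‖ ∂(gauss θ).prod (gauss θ)))
      rw [← integral_const_mul]
      exact integral_mono_of_nonneg (Eventually.of_forall fun p => norm_nonneg _)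
        ((integrable_fieldWeight h₁ h₂).norm.const_mul _)
        (Eventually.of_forall fun p => norm_smearIntegrand_modeKernel_le hθ μ₀ A ε (v γ) p))
  simp only [fun p => (hasSum_smearIntegrand (φ₁ := φ₁) (φ₂ := φ₂) hG p).tsum_eq] at h
  exact h

/-- If all nonzero modes stay away from `v = 0`, their coefficients converge as the cut-off is
removed, with a summable bound that does not depend on it. -/
lemma onlyZeroModeDiverges_of_modes {s₀ : ℝ} {F : ℝ → ℂ} {mode : Label → ℝ → ℂ} (hθ : 0 < θ)
    (hμ₀ : μ₀ ≠ 0) (h₁ : WeightIntegrable θ φ₁) (h₂ : WeightIntegrable θ φ₂)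
    (hs₀ : 0 < s₀) (hvs : ∀ γ, γ ≠ 0 → s₀ ≤ nsq (v γ))
    (hv : Summable fun γ => Real.exp (-(freq θ / 4) * nsq (v γ)))
    (hmode : ∀ ε > 0, ∀ γ, mode γ ε = smear θ (modeKernel θ μ₀ A ε (v γ)) φ₁ φ₂)
    (hF : ∀ ε > 0, HasSum (fun γ => mode γ ε) (F ε)) :
    OnlyZeroModeDiverges F mode := by
  have hmode' : ∀ γ, (fun ε => ((A * modeCoeff θ μ₀ (nsq (v γ)) ε : ℝ) : ℂ) *
      smear θ (translationKernel θ (v γ)) φ₁ φ₂) =ᶠ[𝓝[>] 0] mode γ := fun γ => by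
    filter_upwards [self_mem_nhdsWithin] with ε hε
    rw [hmode ε hε, smear_modeKernel]
  let ℓ : Label → ℂ := fun γ => ((A * modeCoeff θ μ₀ (nsq (v γ)) 0 : ℝ) : ℂ) *
    smear θ (translationKernel θ (v γ)) φ₁ φ₂
  have hlim : ∀ γ, γ ≠ 0 → Tendsto (mode γ) (𝓝[>] 0) (𝓝 (ℓ γ)) := fun γ hγ => by
    refine Tendsto.congr' (hmode' γ) (Tendsto.mul_const _ ?_)
    exact (continuous_ofReal.tendsto _).comp
      ((tendsto_modeCoeff hθ hμ₀ (hs₀.trans_le (hvs γ hγ))).const_mul A)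
  obtain ⟨K, hK⟩ := modeCoeff_le (μ₀ := μ₀) hθ hμ₀ hs₀
  let M := ∫ p, ‖fieldWeight θ φ₁ φ₂ p‖ ∂(gauss θ).prod (gauss θ)
  have hbound : ∀ ε, 0 ≤ ε → ∀ γ, γ ≠ 0 → ‖((A * modeCoeff θ μ₀ (nsq (v γ)) ε : ℝ) : ℂ) *
      smear θ (translationKernel θ (v γ)) φ₁ φ₂‖ ≤
        |A| * (K * Real.exp (-(freq θ / 4) * nsq (v γ))) * M := fun ε hε γ hγ => by
    have hc := hK _ (hvs γ hγ) ε hε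
    rw [norm_mul, norm_real, Real.norm_eq_abs, abs_mul,
      abs_of_nonneg (modeCoeff_nonneg θ μ₀ (nsq (v γ)) ε), neg_mul]
    refine mul_le_mul (mul_le_mul_of_nonneg_left hc (abs_nonneg _))
      (norm_smear_translationKernel_le hθ h₁ h₂ _) (norm_nonneg _) ?_
    exact mul_nonneg (abs_nonneg _) ((modeCoeff_nonneg _ _ _ _).trans hc)
  have hsum : Summable fun γ : {γ : Label // γ ≠ 0} =>
      |A| * (K * Real.exp (-(freq θ / 4) * nsq (v γ))) * M :=
    (((hv.mul_left K).mul_left |A|).mul_right M).subtype _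
  refine ⟨hF, ℓ, hlim, ?_, ?_⟩
  · exact Summable.of_norm_bounded hsum fun γ => hbound 0 le_rfl γ γ.2
  · refine tendsto_tsum_of_dominated_convergence hsum (fun γ => hlim γ γ.2) ?_
    filter_upwards [self_mem_nhdsWithin] with ε hε γ
    rw [hmode ε hε, smear_modeKernel]
    exact hbound ε (le_of_lt hε) γ γ.2

/-- The divergence of a mode with `v = 0`. -/
lemma hasDivergentPart_zeroMode {F : ℝ → ℂ} {w : Phase} {τ : ℂ} (hθ : 0 < θ) (hμ₀ : μ₀ ≠ 0)
    (hw : w = 0) (hτ : smear θ (translationKernel θ 0) φ₁ φ₂ = τ)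
    (hF : ∀ ε > 0, F ε = smear θ (modeKernel θ μ₀ A ε w) φ₁ φ₂) :
    HasDivergentPart F (fun ε => ((A / (2 * freq θ) : ℝ) : ℂ) * τ * (singularFactor θ μ₀ ε : ℂ)) := by
  subst hw
  obtain ⟨ℓ, hℓ⟩ := tendsto_modeCoeff_zero_sub (μ₀ := μ₀) hθ hμ₀
  refine ⟨A * ℓ * τ, ?_⟩
  refine Tendsto.congr' ?_ ((((continuous_ofReal.tendsto _).comp hℓ).const_mul (A : ℂ)).mul_const τ)
  filter_upwards [self_mem_nhdsWithin] with ε hε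
  have h0 : nsq 0 = 0 := by simp [nsq]
  rw [hF ε hε, smear_modeKernel, hτ, h0]
  simp only [Function.comp_apply]
  push_cast
  ring

/-- If only the zero mode diverges, its divergent part is that of the sum. -/
lemma OnlyZeroModeDiverges.hasDivergentPart {F D : ℝ → ℂ} {mode : Label → ℝ → ℂ}
    (h : OnlyZeroModeDiverges F mode) (h0 : HasDivergentPart (mode 0) D) :
    HasDivergentPart F D := by
  obtain ⟨hsum, ℓ, -, -, hlim⟩ := h
  obtain ⟨ℓ₀, hℓ₀⟩ := h0
  refine ⟨_, (hℓ₀.add hlim).congr' ?_⟩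
  filter_upwards [self_mem_nhdsWithin] with ε hε
  have hs := hsum ε hε
  have h1 := hs.summable.tsum_subtype_add_tsum_subtype_compl ({0} : Set Label)
  rw [hs.tsum_eq, tsum_singleton (0 : Label) (fun γ => mode γ ε)] at h1
  have h2 : ∑' γ : {γ : Label // γ ≠ 0}, mode γ ε = ∑' γ : ↑({0}ᶜ : Set Label), mode γ ε := rfl
  rw [h2, ← h1]
  ring

end

/-! ### The Bargmann transform of a Schwartz function -/

/-- The integral kernel of the Bargmann transform, without its normalization. -/
noncomputable def bargmannKernel (θ : ℝ) (z : Phase) (x : Fin 2 → ℝ) : ℂ :=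
  cexp (-(freq θ : ℂ) / 2 * ∑ i, ((x i : ℂ) ^ 2 + z i ^ 2)
    + (Real.sqrt 2 : ℂ) * freq θ * ∑ i, z i * (x i : ℂ))

section
variable {θ : ℝ}

lemma bargmann_eq (θ : ℝ) (f : 𝓢(Fin 2 → ℝ, ℂ)) (z : Phase) :
    bargmann θ f z = (Real.sqrt (freq θ / Real.pi) : ℂ) * ∫ x, bargmannKernel θ z x * f x := rfl

lemma continuous_bargmannKernel (θ : ℝ) :
    Continuous fun p : Phase × (Fin 2 → ℝ) => bargmannKernel θ p.1 p.2 := by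
  unfold bargmannKernel
  fun_prop

lemma continuous_bargmannKernel_right (θ : ℝ) (z : Phase) : Continuous (bargmannKernel θ z) := by
  unfold bargmannKernel
  fun_prop

lemma norm_bargmannKernel_le (hθ : 0 < θ) (z : Phase) (x : Fin 2 → ℝ) :
    ‖bargmannKernel θ z x‖ ≤ Real.exp (freq θ / 2 * nsq z) := by
  have hω := freq_pos hθ
  rw [bargmannKernel, Complex.norm_exp, Real.exp_le_exp]
  have h2 : Real.sqrt 2 ^ 2 = 2 := Real.sq_sqrt (by norm_num)
  have e : (-(freq θ : ℂ) / 2 * ∑ i, ((x i : ℂ) ^ 2 + z i ^ 2)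
      + (Real.sqrt 2 : ℂ) * freq θ * ∑ i, z i * (x i : ℂ)).re =
      freq θ * ∑ i, (-(x i ^ 2 + (z i).re ^ 2 - (z i).im ^ 2) / 2 + Real.sqrt 2 * (z i).re * x i) := by
    rw [show -(freq θ : ℂ) / 2 = ((-freq θ / 2 : ℝ) : ℂ) by push_cast; ring, ← ofReal_mul, add_re,
      re_ofReal_mul, re_ofReal_mul]
    simp only [Fin.sum_univ_two, add_re, sq, mul_re, ofReal_re, ofReal_im]
    ring
  rw [e, nsq_eq_re_im, div_mul_eq_mul_div, mul_div_assoc]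
  refine mul_le_mul_of_nonneg_left ?_ hω.le
  rw [Finset.sum_div]
  refine Finset.sum_le_sum fun i _ => ?_
  nlinarith [sq_nonneg (x i - Real.sqrt 2 * (z i).re)]

lemma integrable_bargmannKernel_mul (hθ : 0 < θ) (f : 𝓢(Fin 2 → ℝ, ℂ)) (z : Phase) :
    Integrable fun x => bargmannKernel θ z x * f x :=
  f.integrable.bdd_mul (continuous_bargmannKernel_right θ z).aestronglyMeasurable
    (Eventually.of_forall (norm_bargmannKernel_le hθ z))

lemma exists_norm_bargmann_le (hθ : 0 < θ) (f : 𝓢(Fin 2 → ℝ, ℂ)) :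
    ∃ C, ∀ z, ‖bargmann θ f z‖ ≤ C * Real.exp (freq θ / 2 * nsq z) := by
  refine ⟨Real.sqrt (freq θ / Real.pi) * ∫ x, ‖f x‖, fun z => ?_⟩
  rw [bargmann_eq, norm_mul, norm_real, Real.norm_of_nonneg (Real.sqrt_nonneg _), mul_assoc]
  refine mul_le_mul_of_nonneg_left ?_ (Real.sqrt_nonneg _)
  rw [mul_comm, ← integral_const_mul]
  refine norm_integral_le_of_norm_le (f.integrable.norm.const_mul _)
    (Eventually.of_forall fun x => ?_)
  rw [norm_mul]
  exact mul_le_mul_of_nonneg_right (norm_bargmannKernel_le hθ z x) (norm_nonneg _)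

lemma stronglyMeasurable_bargmann (θ : ℝ) (f : 𝓢(Fin 2 → ℝ, ℂ)) :
    StronglyMeasurable (bargmann θ f) := by
  have h : Continuous fun p : Phase × (Fin 2 → ℝ) => bargmannKernel θ p.1 p.2 * f p.2 :=
    (continuous_bargmannKernel θ).mul (f.continuous.comp continuous_snd)
  exact h.stronglyMeasurable.integral_prod_right.const_mul _

lemma hasLineDerivAt_bargmannKernel (θ : ℝ) (z : Phase) (x : Fin 2 → ℝ) (i : Fin 2) :
    HasLineDerivAt ℝ (bargmannKernel θ z)
      ((Real.sqrt 2 * freq θ * z i - freq θ * x i) * bargmannKernel θ z x) x (Pi.single i 1) := by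
  have h : ∀ t : ℝ, bargmannKernel θ z (x + t • Pi.single i 1) =
      cexp (-(freq θ : ℂ) / 2 * ∑ j, ((x j : ℂ) ^ 2 + z j ^ 2)
        + (Real.sqrt 2 : ℂ) * freq θ * ∑ j, z j * (x j : ℂ)
        + ((Real.sqrt 2 * freq θ * z i - freq θ * x i) * t - freq θ / 2 * (t : ℂ) ^ 2)) := by
    intro t
    rw [bargmannKernel]
    congr 1
    fin_cases i <;>
    · simp [Fin.sum_univ_two]
      ring
  unfold HasLineDerivAt
  simp only [h]
  have hd : HasDerivAt (fun t : ℝ => (-(freq θ : ℂ) / 2 * ∑ j, ((x j : ℂ) ^ 2 + z j ^ 2)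
        + (Real.sqrt 2 : ℂ) * freq θ * ∑ j, z j * (x j : ℂ)
        + ((Real.sqrt 2 * freq θ * z i - freq θ * x i) * t - freq θ / 2 * (t : ℂ) ^ 2)))
      (Real.sqrt 2 * freq θ * z i - freq θ * x i) 0 := by
    have h1 := (hasDerivAt_id (0 : ℝ)).ofReal_comp
    have h2 := ((h1.const_mul (Real.sqrt 2 * freq θ * z i - freq θ * x i : ℂ)).sub
      ((h1.pow 2).const_mul (freq θ / 2 : ℂ))).const_add
        (-(freq θ : ℂ) / 2 * ∑ j, ((x j : ℂ) ^ 2 + z j ^ 2)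
        + (Real.sqrt 2 : ℂ) * freq θ * ∑ j, z j * (x j : ℂ))
    simpa using h2
  convert! hd.cexp using 1
  rw [bargmannKernel]
  simp
  ring

open scoped LineDeriv

/-- Multiplication by `z i` is the image of a first-order differential operator with linear
coefficients under the Bargmann transform. -/
lemma exists_bargmann_eq_coord_mul (hθ : 0 < θ) (f : 𝓢(Fin 2 → ℝ, ℂ)) (i : Fin 2) :
    ∃ g : 𝓢(Fin 2 → ℝ, ℂ), ∀ z, bargmann θ g z = z i * bargmann θ f z := by
  have hω := freq_pos hθ
  let L : (Fin 2 → ℝ) →L[ℝ] ℂ := ofRealCLM.comp (ContinuousLinearMap.proj i)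
  let xf : 𝓢(Fin 2 → ℝ, ℂ) := SchwartzMap.smulLeftCLM ℂ (L : (Fin 2 → ℝ) → ℂ) f
  have hxf : ∀ x, xf x = x i * f x := fun x => by
    simp only [xf]
    rw [SchwartzMap.smulLeftCLM_apply_apply L.hasTemperateGrowth]
    rfl
  let df : 𝓢(Fin 2 → ℝ, ℂ) := ∂_{(Pi.single i 1 : Fin 2 → ℝ)} f
  let c : ℂ := (Real.sqrt 2 * freq θ : ℂ)
  have hc : c ≠ 0 := mul_ne_zero ofReal_sqrt_two_ne_zero (by exact_mod_cast hω.ne')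
  refine ⟨c⁻¹ • ((freq θ : ℂ) • xf - df), fun z => ?_⟩
  have hI1 := integrable_bargmannKernel_mul hθ f z
  have hI2 := integrable_bargmannKernel_mul hθ df z
  have hI3 := integrable_bargmannKernel_mul hθ xf z
  have hI4 : Integrable fun x =>
      ((Real.sqrt 2 * freq θ * z i - freq θ * x i) * bargmannKernel θ z x) * f x := by
    refine ((hI1.const_mul (c * z i)).sub (hI3.const_mul (freq θ : ℂ))).congr
      (Eventually.of_forall fun x => ?_)
    simp only [Pi.sub_apply, hxf, c]
    ring
  have hparts : ∫ x, bargmannKernel θ z x * df x =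
      -∫ x, ((Real.sqrt 2 * freq θ * z i - freq θ * x i) * bargmannKernel θ z x) * f x :=
    integral_bilinear_hasLineDerivAt_right_eq_neg_left_of_integrable
      (v := Pi.single i 1) (B := ContinuousLinearMap.mul ℝ ℂ) hI4 hI2 hI1
      (fun x _ => hasLineDerivAt_bargmannKernel θ z x i)
      (fun x _ => by
        rw [show df x = fderiv ℝ f x (Pi.single i 1) from
          SchwartzMap.lineDerivOp_apply_eq_fderiv _ _ _]
        exact (f.hasFDerivAt x).hasLineDerivAt _)
  have e1 : ∫ x, ((Real.sqrt 2 * freq θ * z i - freq θ * x i) * bargmannKernel θ z x) * f x =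
      c * z i * (∫ x, bargmannKernel θ z x * f x) - freq θ * ∫ x, bargmannKernel θ z x * xf x := by
    rw [← integral_const_mul, ← integral_const_mul,
      ← integral_sub (hI1.const_mul _) (hI3.const_mul _)]
    refine integral_congr_ae (Eventually.of_forall fun x => ?_)
    simp only [hxf, c]
    ring
  have e2 : ∫ x, bargmannKernel θ z x * (c⁻¹ • ((freq θ : ℂ) • xf - df)) x =
      c⁻¹ * (freq θ * (∫ x, bargmannKernel θ z x * xf x) - ∫ x, bargmannKernel θ z x * df x) := by
    rw [← integral_const_mul, ← integral_sub (hI3.const_mul _) hI2, ← integral_const_mul]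
    refine integral_congr_ae (Eventually.of_forall fun x => ?_)
    simp only [_root_.smul_apply, _root_.sub_apply, smul_eq_mul]
    ring
  rw [bargmann_eq, bargmann_eq, e2, hparts, e1]
  field_simp
  ring

lemma exists_bargmann_eq_coord_pow_mul (hθ : 0 < θ) (f : 𝓢(Fin 2 → ℝ, ℂ)) (i : Fin 2) (n : ℕ) :
    ∃ g : 𝓢(Fin 2 → ℝ, ℂ), ∀ z, bargmann θ g z = z i ^ n * bargmann θ f z := by
  induction n with
  | zero => exact ⟨f, fun z => by simp⟩
  | succ n ih =>
    obtain ⟨g, hg⟩ := ih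
    obtain ⟨h, hh⟩ := exists_bargmann_eq_coord_mul hθ g i
    exact ⟨h, fun z => by rw [hh, hg]; ring⟩

lemma norm_pow_le_sum (z : Phase) (n : ℕ) : ‖z‖ ^ n ≤ ‖z 0‖ ^ n + ‖z 1‖ ^ n := by
  have h : ‖z‖ ≤ max ‖z 0‖ ‖z 1‖ :=
    (pi_norm_le_iff_of_nonneg (by positivity)).2
      (Fin.forall_fin_two.2 ⟨le_max_left _ _, le_max_right _ _⟩)
  rcases le_max_iff.1 h with h | h
  · exact (pow_le_pow_left₀ (norm_nonneg _) h n).trans (le_add_of_nonneg_right (by positivity))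
  · exact (pow_le_pow_left₀ (norm_nonneg _) h n).trans (le_add_of_nonneg_left (by positivity))

/-- The Bargmann transform of a Schwartz function decays faster than `exp(ω |z|²/2)` by any
power. -/
lemma exists_bargmann_decay (hθ : 0 < θ) (f : 𝓢(Fin 2 → ℝ, ℂ)) (n : ℕ) :
    ∃ C, ∀ z, (1 + ‖z‖) ^ n * ‖bargmann θ f z‖ ≤ C * Real.exp (freq θ / 2 * nsq z) := by
  obtain ⟨g₀, hg₀⟩ := exists_bargmann_eq_coord_pow_mul hθ f 0 n
  obtain ⟨g₁, hg₁⟩ := exists_bargmann_eq_coord_pow_mul hθ f 1 n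
  obtain ⟨C, hC⟩ := exists_norm_bargmann_le hθ f
  obtain ⟨C₀, hC₀⟩ := exists_norm_bargmann_le hθ g₀
  obtain ⟨C₁, hC₁⟩ := exists_norm_bargmann_le hθ g₁
  refine ⟨2 ^ (n - 1) * (C + (C₀ + C₁)), fun z => ?_⟩
  have h0 := hC₀ z
  have h1 := hC₁ z
  rw [hg₀, norm_mul, norm_pow] at h0
  rw [hg₁, norm_mul, norm_pow] at h1
  have h2 : (1 + ‖z‖) ^ n ≤ 2 ^ (n - 1) * (1 + (‖z 0‖ ^ n + ‖z 1‖ ^ n)) := by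
    refine (add_pow_le zero_le_one (norm_nonneg z) n).trans ?_
    rw [one_pow]
    gcongr
    exact norm_pow_le_sum z n
  refine (mul_le_mul_of_nonneg_right h2 (norm_nonneg _)).trans ?_
  rw [mul_assoc, mul_assoc]
  refine mul_le_mul_of_nonneg_left ?_ (by positivity)
  linarith [hC z]

lemma weightIntegrable_bargmann (hθ : 0 < θ) (f : 𝓢(Fin 2 → ℝ, ℂ)) :
    WeightIntegrable θ (bargmann θ f) := by
  -- The power `5` exceeds the real dimension `4` of the phase space.
  obtain ⟨C, hC⟩ := exists_bargmann_decay hθ f 5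
  rw [WeightIntegrable, integrable_gauss_iff hθ]
  have hfin : (Module.finrank ℝ Phase : ℝ) < 5 := by
    rw [Module.finrank_pi_fintype]
    simp
    norm_num
  refine ((integrable_one_add_norm (μ := volume) hfin).const_mul C).mono' ?_
    (Eventually.of_forall fun z => ?_)
  · have h1 : Continuous fun z : Phase => Real.exp (-freq θ * nsq z) := by fun_prop
    have h2 : Continuous fun z : Phase => (Real.exp (freq θ / 2 * nsq z) : ℂ) := by fun_prop
    exact (h1.stronglyMeasurable.smul
      (h2.stronglyMeasurable.mul (stronglyMeasurable_bargmann θ f))).aestronglyMeasurable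
  · rw [norm_smul, norm_mul, norm_real, Real.norm_of_nonneg (Real.exp_pos _).le,
      Real.norm_of_nonneg (Real.exp_pos _).le, ← mul_assoc, ← Real.exp_add, Real.rpow_neg
      (by positivity), ← div_eq_mul_inv, le_div_iff₀ (by positivity)]
    have h5 : (1 + ‖z‖) ^ (5 : ℝ) = (1 + ‖z‖) ^ 5 := by
      rw [← Real.rpow_natCast]; norm_num
    rw [h5, mul_assoc, mul_comm ‖bargmann θ f z‖]
    refine (mul_le_mul_of_nonneg_left (hC z) (Real.exp_pos _).le).trans_eq ?_
    rw [mul_left_comm, ← Real.exp_add, Real.exp_eq_one_iff _ |>.2 (by ring), mul_one]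

/-! ### The reproducing property on the smooth module -/

lemma norm_idKernel_le (hθ : 0 < θ) (z w : Phase) :
    ‖idKernel θ z w‖ ≤ Real.exp (freq θ * nsq z) * Real.exp (freq θ / 4 * nsq w) := by
  have hω := freq_pos hθ
  rw [idKernel, Complex.norm_exp, ← Real.exp_add, Real.exp_le_exp, re_ofReal_mul]
  have h1 : (cdot w z).re ≤ nsq z + nsq w / 4 := by
    simp only [cdot_re, nsq_eq_re_im, Fin.sum_univ_two]
    nlinarith [sq_nonneg ((w 0).re / 2 - (z 0).re), sq_nonneg ((w 0).im / 2 - (z 0).im),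
      sq_nonneg ((w 1).re / 2 - (z 1).re), sq_nonneg ((w 1).im / 2 - (z 1).im)]
  nlinarith [mul_le_mul_of_nonneg_left h1 hω.le]

/-- The Bargmann kernel is holomorphic in `w`, so it is reproduced; its term `exp(-ω w²/2)` is
what needs Gaussian integrals with a holomorphic quadratic part. -/
lemma integral_idKernel_bargmannKernel (hθ : 0 < θ) (z : Phase) (x : Fin 2 → ℝ) :
    ∫ w, idKernel θ z w * bargmannKernel θ w x ∂gauss θ = bargmannKernel θ z x := by
  have h := integral_gauss_cexp (A := 1) (s := -1 / 2) hθ (by norm_num) (by norm_num)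
    (fun i => (Real.sqrt 2 : ℂ) * x i) z
  have h' := congrArg (fun u => cexp (-(freq θ : ℂ) / 2 * ∑ i, (x i : ℂ) ^ 2) * u) h
  rw [← integral_const_mul] at h'
  convert! h' using 1
  · refine integral_congr_ae (Eventually.of_forall fun w => ?_)
    simp only [idKernel, bargmannKernel, ← Complex.exp_add, cdot, Fin.sum_univ_two]
    congr 1
    push_cast
    ring
  · simp only [bargmannKernel, Fin.sum_univ_two]
    rw [ofReal_one, one_pow, div_one, one_mul, ← Complex.exp_add]
    congr 1
    push_cast
    ring

lemma integral_idKernel_bargmann (hθ : 0 < θ) (f : 𝓢(Fin 2 → ℝ, ℂ)) (z : Phase) :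
    ∫ w, idKernel θ z w * bargmann θ f w ∂gauss θ = bargmann θ f z := by
  have hω := freq_pos hθ
  have hint : Integrable (fun p : Phase × (Fin 2 → ℝ) =>
      idKernel θ z p.1 * (bargmannKernel θ p.1 p.2 * f p.2)) ((gauss θ).prod volume) := by
    refine (((integrable_gauss_exp_nsq (a := freq θ * (3 / 4)) hθ (by linarith)).const_mul
      (Real.exp (freq θ * nsq z))).mul_prod f.integrable.norm).mono'
      (Continuous.aestronglyMeasurable ?_) (Eventually.of_forall fun p => ?_)
    · refine Continuous.mul ?_ ((continuous_bargmannKernel θ).mul (f.continuous.comp continuous_snd))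
      unfold idKernel cdot
      fun_prop
    · rw [norm_mul, norm_mul, ← mul_assoc]
      refine mul_le_mul_of_nonneg_right ?_ (norm_nonneg _)
      refine (mul_le_mul (norm_idKernel_le hθ z p.1) (norm_bargmannKernel_le hθ p.1 p.2)
        (norm_nonneg _) (by positivity)).trans_eq ?_
      simp only [← Real.exp_add]
      congr 1
      ring
  simp only [bargmann_eq]
  rw [show (fun w => idKernel θ z w * ((Real.sqrt (freq θ / Real.pi) : ℂ) *
      ∫ x, bargmannKernel θ w x * f x)) = fun w => (Real.sqrt (freq θ / Real.pi) : ℂ) *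
      ∫ x, idKernel θ z w * (bargmannKernel θ w x * f x) by
    ext w
    rw [integral_const_mul]
    ring, integral_const_mul, integral_integral_swap hint]
  congr 1
  refine integral_congr_ae (Eventually.of_forall fun x => ?_)
  simp only [← mul_assoc]
  rw [integral_mul_const, integral_idKernel_bargmannKernel hθ]

lemma translation_zero (θ : ℝ) (φ : Phase → ℂ) : translation θ 0 φ = φ := by
  ext z
  simp [translation, nsq, cdot]

lemma translationKernel_zero (θ : ℝ) (z w : Phase) : translationKernel θ 0 z w = idKernel θ z w := by
  simp [translationKernel, nsq, cdot]

lemma latticePoint_zero (θ : ℝ) : latticePoint θ 0 = 0 := by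
  ext i
  simp [latticePoint, phasePoint]

lemma dualPoint_zero : dualPoint 0 = 0 := by
  ext i
  simp [dualPoint]

/-- The zero mode evaluates the external fields in the trace of their torus-valued pairing. -/
lemma smear_translationKernel_zero {φ₁ φ₂ : Phase → ℂ} (hθ : 0 < θ)
    (h₁ : φ₁ ∈ smoothModule θ) (h₂ : φ₂ ∈ smoothModule θ) :
    smear θ (translationKernel θ 0) φ₁ φ₂ = torusTrace (torusPairing θ φ₁ φ₂) := by
  obtain ⟨f₁, rfl⟩ := h₁
  obtain ⟨f₂, rfl⟩ := h₂
  rw [smear, integral_prod _ (integrable_smear_translationKernel hθ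
    (weightIntegrable_bargmann hθ f₁) (weightIntegrable_bargmann hθ f₂) 0), torusTrace,
    torusPairing, neg_zero, latticePoint_zero, translation_zero, scalar]
  refine integral_congr_ae (Eventually.of_forall fun z => ?_)
  simp only [smearIntegrand, translationKernel_zero]
  rw [← integral_idKernel_bargmann hθ f₂ z, ← integral_const_mul]
  refine integral_congr_ae (Eventually.of_forall fun w => ?_)
  simp only
  ring

end

/-! ### The regularized theory -/

lemma WeightIntegrable.of_mem_smoothModule {θ : ℝ} {φ : Phase → ℂ} (hθ : 0 < θ)
    (h : φ ∈ smoothModule θ) : WeightIntegrable θ φ := by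
  obtain ⟨f, rfl⟩ := h
  exact weightIntegrable_bargmann hθ f

section
variable {θ μ₀ : ℝ} {φ₁ φ₂ : Phase → ℂ}

lemma wellDefined {ε : ℝ} (hθ : 0 < θ) (hμ₀ : μ₀ ≠ 0) (hε : 0 < ε) (lam : ℝ)
    (h₁ : WeightIntegrable θ φ₁) (h₂ : WeightIntegrable θ φ₂) :
    WellDefined θ lam μ₀ ε φ₁ φ₂ := by
  have hω := freq_pos hθ
  have hloop := gaussianVertex_loop hθ (decayRate_pos hθ hε).le (decayRate_le_one (θ := θ)) lam
  have hline := gaussianVertex_line hθ (decayRate_pos hθ hε).le (decayRate_le_one (θ := θ)) lam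
  have hv := summable_exp_nsq_latticePoint hθ (decay_pos hθ hε)
  exact
    { propagator_conv := integrableOn_heatKernel hθ hμ₀
      vertex_conv := fun z₁ z₂ z₃ z₄ => (hloop z₁ z₂).summable_apply hv (z₃, z₄)
      loop_conv := fun z₁ z₂ => (hloop z₁ z₂).integrable_tsum hθ hε hμ₀ hv
      line_conv := fun z₁ z₂ => (hline z₁ z₂).integrable_tsum hθ hε hμ₀ hv
      loop_smear := integrable_smear_of_hasSum hθ hμ₀ hε h₁ h₂
        (summable_exp_nsq_latticePoint hθ (by positivity)) (hasSum_loopGraph hθ hμ₀ hε lam)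
      line_smear := integrable_smear_of_hasSum hθ hμ₀ hε h₁ h₂
        (summable_exp_nsq_dualPoint (by positivity)) (hasSum_lineGraph hθ hμ₀ hε lam)
      loop_mode := fun v z₁ z₂ => (hloop z₁ z₂).integrable_propagator hθ hε hμ₀ v
      line_mode := fun v z₁ z₂ => (hline z₁ z₂).integrable_propagator hθ hε hμ₀ v
      dual_mode := integrable_dualIntegrand hθ hμ₀ hε lam
      loop_mode_smear := fun γ => by
        rw [loopMode_eq hθ hμ₀ hε]
        exact integrable_smear_modeKernel hθ h₁ h₂ _ _ _ _
      dual_mode_smear := fun k => by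
        rw [dualMode_eq hθ hμ₀ hε]
        exact integrable_smear_modeKernel hθ h₁ h₂ _ _ _ _ }

lemma onlyZeroModeDiverges_loop (hθ : 0 < θ) (hμ₀ : μ₀ ≠ 0) (lam : ℝ)
    (h₁ : WeightIntegrable θ φ₁) (h₂ : WeightIntegrable θ φ₂) :
    OnlyZeroModeDiverges (fun ε => smear θ (loopGraph θ μ₀ ε (vertex θ lam)) φ₁ φ₂)
      (fun γ ε => smear θ (loopMode θ lam μ₀ ε γ) φ₁ φ₂) := by
  have hω := freq_pos hθ
  have hv := summable_exp_nsq_latticePoint hθ (by positivity : 0 < freq θ / 4)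
  refine onlyZeroModeDiverges_of_modes (s₀ := θ ^ 2 / 2) (v := latticePoint θ) (A := lam)
    hθ hμ₀ h₁ h₂ (by positivity) (fun γ hγ => ?_) hv (fun ε hε γ => ?_) (fun ε hε => ?_)
  · rw [nsq_latticePoint]
    exact le_mul_of_one_le_right (by positivity) (one_le_labelSq hγ)
  · rw [loopMode_eq hθ hμ₀ hε]
  · simp only [loopMode_eq hθ hμ₀ hε]
    exact hasSum_smear_of_hasSum hθ hμ₀ hε h₁ h₂ hv (hasSum_loopGraph hθ hμ₀ hε lam)

lemma onlyZeroModeDiverges_line (hθ : 0 < θ) (hμ₀ : μ₀ ≠ 0) (lam : ℝ)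
    (h₁ : WeightIntegrable θ φ₁) (h₂ : WeightIntegrable θ φ₂) :
    OnlyZeroModeDiverges (fun ε => smear θ (lineGraph θ μ₀ ε (vertex θ lam)) φ₁ φ₂)
      (fun k ε => smear θ (dualMode θ lam μ₀ ε k) φ₁ φ₂) := by
  have hω := freq_pos hθ
  have hv := summable_exp_nsq_dualPoint (by positivity : 0 < freq θ / 4)
  refine onlyZeroModeDiverges_of_modes (s₀ := 1 / 2) (v := dualPoint) (A := lam * (1 / θ ^ 2))
    hθ hμ₀ h₁ h₂ (by norm_num) (fun k hk => ?_) hv (fun ε hε k => ?_) (fun ε hε => ?_)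
  · rw [nsq_dualPoint]
    linarith [one_le_labelSq hk]
  · rw [dualMode_eq hθ hμ₀ hε]
  · simp only [dualMode_eq hθ hμ₀ hε]
    exact hasSum_smear_of_hasSum hθ hμ₀ hε h₁ h₂ hv (hasSum_lineGraph hθ hμ₀ hε lam)

end

lemma HasDivergentPart.add {F F' D D' : ℝ → ℂ} (h : HasDivergentPart F D)
    (h' : HasDivergentPart F' D') :
    HasDivergentPart (fun ε => F ε + F' ε) (fun ε => D ε + D' ε) := by
  obtain ⟨ℓ, hℓ⟩ := h
  obtain ⟨ℓ', hℓ'⟩ := h'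
  exact ⟨ℓ + ℓ', (hℓ.add hℓ').congr fun ε => by ring⟩

lemma HasDivergentPart.congr_fun {F F' D D' : ℝ → ℂ} (h : HasDivergentPart F D)
    (hF : ∀ ε > 0, F ε = F' ε) (hD : ∀ ε, D ε = D' ε) : HasDivergentPart F' D' := by
  obtain ⟨ℓ, hℓ⟩ := h
  refine ⟨ℓ, hℓ.congr' ?_⟩
  filter_upwards [self_mem_nhdsWithin] with ε hε
  rw [hF ε hε, hD]

lemma smear_twoPoint {θ lam μ₀ ε : ℝ} {φ₁ φ₂ : Phase → ℂ} (h : WellDefined θ lam μ₀ ε φ₁ φ₂) :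
    smear θ (twoPoint θ lam μ₀ ε) φ₁ φ₂ = smear θ (loopGraph θ μ₀ ε (vertex θ lam)) φ₁ φ₂ +
      smear θ (lineGraph θ μ₀ ε (vertex θ lam)) φ₁ φ₂ := by
  rw [smear, smear, smear, ← integral_add h.loop_smear h.line_smear]
  refine integral_congr_ae (Eventually.of_forall fun p => ?_)
  simp only [smearIntegrand, twoPoint]
  ring

end HeisenbergModule

theorem mainTheorem4 (θ lam μ₀ : ℝ) (hθ : 0 < θ) (hμ₀ : μ₀ ≠ 0)
    (φ₁ φ₂ : Phase → ℂ)
    (hφ₁ : φ₁ ∈ smoothModule θ)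
    (hφ₂ : φ₂ ∈ smoothModule θ) :
    (∀ ε > 0, WellDefined θ lam μ₀ ε φ₁ φ₂) ∧
    -- the divergent part of the two-point function
    HasDivergentPart
      (fun ε => smear θ (twoPoint θ lam μ₀ ε) φ₁ φ₂)
      (fun ε => ((lam / (2 * freq θ) * (1 + 1 / θ ^ 2) : ℝ) : ℂ)
        * torusTrace (torusPairing θ φ₁ φ₂)
        * (singularFactor θ μ₀ ε : ℂ)) ∧
    -- the graph with a closed loop: only the mode `γ = 0` diverges
    OnlyZeroModeDiverges
      (fun ε => smear θ
        (loopGraph θ μ₀ ε (vertex θ lam)) φ₁ φ₂)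
      (fun γ ε => smear θ (loopMode θ lam μ₀ ε γ) φ₁ φ₂) ∧
    HasDivergentPart
      (fun ε => smear θ (loopMode θ lam μ₀ ε 0) φ₁ φ₂)
      (fun ε => ((lam / (2 * freq θ) : ℝ) : ℂ)
        * torusTrace (torusPairing θ φ₁ φ₂)
        * (singularFactor θ μ₀ ε : ℂ)) ∧
    -- the graph without a closed loop, Poisson resummed: only the mode `γ* = 0` diverges
    OnlyZeroModeDiverges
      (fun ε => smear θ
        (lineGraph θ μ₀ ε (vertex θ lam)) φ₁ φ₂)
      (fun k ε => smear θ (dualMode θ lam μ₀ ε k) φ₁ φ₂) ∧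
    HasDivergentPart
      (fun ε => smear θ (dualMode θ lam μ₀ ε 0) φ₁ φ₂)
      (fun ε => ((lam / (2 * freq θ) * (1 / θ ^ 2) : ℝ) : ℂ)
        * torusTrace (torusPairing θ φ₁ φ₂)
        * (singularFactor θ μ₀ ε : ℂ)) := by
  have h₁ := WeightIntegrable.of_mem_smoothModule hθ hφ₁
  have h₂ := WeightIntegrable.of_mem_smoothModule hθ hφ₂
  have hτ := smear_translationKernel_zero hθ hφ₁ hφ₂
  have hwell := fun ε (hε : ε > 0) => wellDefined hθ hμ₀ hε lam h₁ h₂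
  have hloop := onlyZeroModeDiverges_loop hθ hμ₀ lam h₁ h₂
  have hline := onlyZeroModeDiverges_line hθ hμ₀ lam h₁ h₂
  have hloop₀ := hasDivergentPart_zeroMode (A := lam) (w := latticePoint θ 0)
    (F := fun ε => smear θ (loopMode θ lam μ₀ ε 0) φ₁ φ₂) hθ hμ₀ (latticePoint_zero θ) hτ
    (fun ε hε => by rw [loopMode_eq hθ hμ₀ hε])
  have hline₀ := hasDivergentPart_zeroMode (A := lam * (1 / θ ^ 2)) (w := dualPoint 0)
    (F := fun ε => smear θ (dualMode θ lam μ₀ ε 0) φ₁ φ₂) hθ hμ₀ dualPoint_zero hτ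
    (fun ε hε => by rw [dualMode_eq hθ hμ₀ hε])
  refine ⟨hwell, ?_, hloop, hloop₀, hline, ?_⟩
  · refine ((hloop.hasDivergentPart hloop₀).add (hline.hasDivergentPart hline₀)).congr_fun
      (fun ε hε => (smear_twoPoint (hwell ε hε)).symm) fun ε => ?_
    push_cast
    ring
  · refine hline₀.congr_fun (fun ε _ => rfl) fun ε => ?_
    push_cast
    ring
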